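/- **Setting.** Let $Y$ and $U$ be Hilbert spaces over the same field $\mathbb K\in\{\mathbb R,\mathbb C\}$, let $A:D(A)\subset Y\to Y$ generate a $C_0$-semigroup $\{S(t)\}_{t\ge 0}$ on $Y$, and let $B\in\mathcal L(U;Y)$. Consider the control system $$y'(t)=Ay(t)+Bu(t),\qquad t>0. \tag{1}$$ For $T>0$ let $(H_Tf)(t):=f([t/T]\,T)$, where $[\cdot]$ is the integer part. Let $\mathcal F_{T,\infty}$ be the set of all $F:(0,\infty)\to\mathcal L(Y;U)$ such that $t\mapsto F(t)y$ is measurable for every $y\in Y$, $\|F(\cdot)\|_{\mathcal L(Y;U)}$ is locally essentially bounded on $(0,\infty)$, and $F(t+T)=F(t)$ for a.e. $t>0$. Solutions of a closed-loop system, where $u$ is expressed through $y$, are mild solutions: $y\in C([0,\infty);Y)$, the function $u$ is locally integrable, and $y(t)=S(t)y(0)+\int_0^tS(t-s)Bu(s)\,ds$ for all $t\ge0$. A closed-loop system is exponentially stable if there are constants $C,\omega>0$ such that for each $y_0\in Y$ a solution with $y(0)=y_0$ exists and every such solution satisfies $\|y(t)\|_Y\le Ce^{-\omega t}\|y_0\|_Y$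 for all $t\ge 0$. System (1) is called * **(CC)**-stabilizable if there is an $F\in\mathcal L(Y;U)$ such that $y'(t)=Ay(t)+BFy(t)$ is exponentially stable; * **(DC)**$_T$-stabilizable if there is an $F\in\mathcal L(Y;U)$ such that $y'(t)=Ay(t)+BF(H_Ty)(t)$ is exponentially stable; * **(DP)**$_T$-stabilizable if there is an $F(\cdot)\in\mathcal F_{T,\infty}$ such that $y'(t)=Ay(t)+BF(t)(H_Ty)(t)$ is exponentially stable; * **(CP)**$_T$-stabilizable if there is an $F(\cdot)\in\mathcal F_{T,\infty}$ such that $y'(t)=Ay(t)+BF(t)y(t)$ is exponentially stable. **Theorem.** For every system (1) as above: 1. If (1) is (DC)$_T$-stabilizable for some $T>0$, then it is (CC)-stabilizable. The converse fails in general: over each $\mathbb K\in\{\mathbb R,\mathbb C\}$ there is a system that is (CC)-stabilizable but is not (DC)$_T$-stabilizable for any $T>0$. 2. (DP)$_T$-stabilizability for some $T>0$ is equivalent to (CC)-stabilizability, and so is (DP)$_T$-stabilizability for all $T>0$. 3. (CP)$_T$-stabilizability for some $T>0$ is equivalent to (CC)-stabilizability, and so is (CP)$_T$-stabilizability for all $T>0$.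 4. If (1) is (DC)$_T$-stabilizable for some $T>0$, then it is (DP)$_T$-stabilizable for all $T>0$. The converse fails in general: over each $\mathbb K\in\{\mathbb R,\mathbb C\}$ there is a system that is (DP)$_T$-stabilizable for all $T>0$ but is not (DC)$_T$-stabilizable for any $T>0$. 5. (DP)$_T$-stabilizability for all $T>0$, (DP)$_T$-stabilizability for some $T>0$, (CP)$_T$-stabilizability for all $T>0$ and (CP)$_T$-stabilizability for some $T>0$ are equivalent: each of the first two is equivalent to each of the last two. -/

import Mathlib

open Filter Topology MeasureTheory Set

universe u v w

/-- `S` (only its values on `[0, ∞)` matter) is a strongly continuous one-parameter semigroup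
of bounded linear operators on `Y`. -/
structure IsC0Semigroup {𝕜 Y : Type*} [RCLike 𝕜] [NormedAddCommGroup Y] [InnerProductSpace 𝕜 Y]
    (S : ℝ → Y →L[𝕜] Y) : Prop where
  map_zero : S 0 = ContinuousLinearMap.id 𝕜 Y
  map_add : ∀ s t : ℝ, 0 ≤ s → 0 ≤ t → S (s + t) = (S s).comp (S t)
  tendsto_zero : ∀ y : Y, Tendsto (fun t : ℝ => S t y) (𝓝[>] 0) (𝓝 y)

/-- `A` is the infinitesimal generator of `S`: its domain consists of all `y` for which
`(S(h) y - y) / h` converges as `h → 0+`, and `A y` is the limit. -/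
def IsGeneratorOf {𝕜 Y : Type*} [RCLike 𝕜] [NormedAddCommGroup Y] [InnerProductSpace 𝕜 Y]
    (A : Y →ₗ.[𝕜] Y) (S : ℝ → Y →L[𝕜] Y) : Prop :=
  ∀ y z : Y, (y, z) ∈ A.graph ↔
    Tendsto (fun h : ℝ => ((h : 𝕜)⁻¹) • (S h y - y)) (𝓝[>] 0) (𝓝 z)

/-- The data of a control system `y'(t) = A y(t) + B u(t)`: the operator `A` generates the
strongly continuous semigroup `S` on the state space `Y`, and the control operator `B` is bounded
from the control space `U` to `Y`. -/
structure ControlSystem (𝕜 Y U : Type*) [RCLike 𝕜]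
    [NormedAddCommGroup Y] [InnerProductSpace 𝕜 Y]
    [NormedAddCommGroup U] [InnerProductSpace 𝕜 U] where
  A : Y →ₗ.[𝕜] Y
  S : ℝ → Y →L[𝕜] Y
  isC0Semigroup : IsC0Semigroup S
  isGeneratorOf : IsGeneratorOf A S
  B : U →L[𝕜] Y

/-- The `T`-periodic sampling operator `(H_T f)(t) = f([t/T] T)`. -/
noncomputable def sampling {Y : Type*} (T : ℝ) (f : ℝ → Y) : ℝ → Y :=
  fun t => f ((⌊t / T⌋₊ : ℝ) * T)

/-- The class of `T`-periodic feedback laws: locally essentially bounded maps `F` from `(0, ∞)`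
to the bounded linear operators `Y → U` with `F(t + T) = F(t)` for a.e. `t > 0`. As usual for
functions with values in the operators between infinite-dimensional spaces, `F` is measurable in
the strong sense, that is, `t ↦ F(t) y` is measurable for every `y`. -/
structure IsPeriodicFeedback {𝕜 Y U : Type*} [RCLike 𝕜]
    [NormedAddCommGroup Y] [InnerProductSpace 𝕜 Y]
    [NormedAddCommGroup U] [InnerProductSpace 𝕜 U]
    (T : ℝ) (F : ℝ → Y →L[𝕜] U) : Prop where
  aestronglyMeasurable : ∀ y : Y,
    AEStronglyMeasurable (fun t => F t y) (volume.restrict (Ioi (0 : ℝ)))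
  locally_bounded : ∀ K : Set ℝ, IsCompact K → K ⊆ Ioi 0 →
    ∃ M : ℝ, ∀ᵐ t ∂(volume.restrict K), ‖F t‖ ≤ M
  periodic : ∀ᵐ t ∂(volume.restrict (Ioi (0 : ℝ))), F (t + T) = F t

namespace ControlSystem

variable {𝕜 Y U : Type*} [RCLike 𝕜]
  [NormedAddCommGroup Y] [InnerProductSpace 𝕜 Y]
  [NormedAddCommGroup U] [InnerProductSpace 𝕜 U]

/-- `y` is the (mild) solution in `C([0, ∞); Y)` of `y' = A y + B u`, `y(0) = y₀`, with a locally
integrable control `u`:  `y(t) = S(t) y₀ + ∫₀ᵗ S(t - s) B u(s) ds` for all `t ≥ 0`. -/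
def IsSolution (sys : ControlSystem 𝕜 Y U) (u : ℝ → U) (y₀ : Y) (y : ℝ → Y) : Prop :=
  letI : NormedSpace ℝ Y := NormedSpace.restrictScalars ℝ 𝕜 Y
  ContinuousOn y (Ici 0) ∧
    ∀ t : ℝ, 0 ≤ t → IntegrableOn u (Ioc 0 t) ∧
      y t = sys.S t y₀ + ∫ s in (0 : ℝ)..t, sys.S (t - s) (sys.B (u s))

/-- Exponential stability of the closed-loop system `y' = A y + B (𝒦 y)`, where `𝒦` sends a
trajectory `y` to the control that is fed back: every initial state is the start of a solution,
and all solutions satisfy `‖y(t)‖ ≤ C e^{-ωt} ‖y(0)‖` with constants `C, ω > 0`. -/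
def ClosedLoopExpStable (sys : ControlSystem 𝕜 Y U) (𝒦 : (ℝ → Y) → ℝ → U) : Prop :=
  ∃ C : ℝ, 0 < C ∧ ∃ ω : ℝ, 0 < ω ∧ ∀ y₀ : Y,
    (∃ y : ℝ → Y, sys.IsSolution (𝒦 y) y₀ y) ∧
    ∀ y : ℝ → Y, sys.IsSolution (𝒦 y) y₀ y →
      ∀ t : ℝ, 0 ≤ t → ‖y t‖ ≤ C * Real.exp (-(ω * t)) * ‖y₀‖

/-- Continuous observation, constant feedback: `y' = A y + B F y`. -/
def CCStabilizable (sys : ControlSystem 𝕜 Y U) : Prop :=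
  ∃ F : Y →L[𝕜] U, sys.ClosedLoopExpStable (fun y t => F (y t))

/-- `T`-periodic discrete observation, constant feedback: `y' = A y + B F (H_T y)(t)`. -/
def DCStabilizable (sys : ControlSystem 𝕜 Y U) (T : ℝ) : Prop :=
  ∃ F : Y →L[𝕜] U, sys.ClosedLoopExpStable (fun y t => F (sampling T y t))

/-- `T`-periodic discrete observation, `T`-periodic feedback: `y' = A y + B F(t) (H_T y)(t)`. -/
def DPStabilizable (sys : ControlSystem 𝕜 Y U) (T : ℝ) : Prop :=
  ∃ F : ℝ → Y →L[𝕜] U, IsPeriodicFeedback T F ∧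
    sys.ClosedLoopExpStable (fun y t => F t (sampling T y t))

/-- Continuous observation, `T`-periodic feedback: `y' = A y + B F(t) y(t)`. -/
def CPStabilizable (sys : ControlSystem 𝕜 Y U) (T : ℝ) : Prop :=
  ∃ F : ℝ → Y →L[𝕜] U, IsPeriodicFeedback T F ∧
    sys.ClosedLoopExpStable (fun y t => F t (y t))

end ControlSystem

/-! Everything is compared with (CC). From a constant continuous feedback with closed-loop operators
`Z t`, the state at time `t` is recovered from the last sample by `Z t = Z (t - [t/T]T) ∘ Z
([t/T]T)`. So `F ∘ Z (t - [t/T]T)` is a periodic gain that acts on samples and produces the same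
trajectories, which gives (DP) for every `T` (`CCStabilizable.dpStabilizable`). A constant gain is
periodic, so (CC) implies (CP) and (DC) implies (DP).

Conversely, a stabilizing law of type (DP) or (CP) provides, for each initial state `x`, a control
and a state that both decay exponentially. Only this open-loop information is kept
(`ccStabilizable_of_openLoop`). It makes the infimum `V x` of `∫ ‖u‖² + ‖y‖²` finite and at most a
multiple of `‖x‖²`. Orthogonal projection in `L²` gives a bounded operator `L` with `V x = ‖L x‖²`;
neither optimal controls nor a Riccati equation are needed. With the feedback `-B* L* L`, dynamic
programming with near-optimal controls shows that the upper right derivative of `V` along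
closed-loop trajectories is at most `-‖z‖²` (`eventually_value_closedLoop_sub_le`). Hence `∫ ‖z‖² ≤
‖L‖² ‖x‖²`, and Datko's theorem gives exponential decay.

The counterexample rotates the `k`-th plane of `ℓ²(ℕ; 𝕜²)` with angular velocity `k`, with full
control. Feedback by `-1` gives decay `e^{-t}`. Under sampled constant feedback the control is
frozen on each sampling interval, and the rotation averages its effect on plane `k` down to
`O(1/k)`, so high modes do not decay at a uniform rate. -/

set_option linter.unusedSectionVars false

open scoped BoundedContinuousFunction

/-! ### Growth bounds and joint continuity of strongly continuous semigroups. -/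

namespace IsC0Semigroup

variable {𝕜 Y : Type*} [RCLike 𝕜] [NormedAddCommGroup Y] [InnerProductSpace 𝕜 Y]
  {S : ℝ → Y →L[𝕜] Y}

/-- Otherwise the norms blow up along some times tending to `0`, while strong convergence bounds
every orbit along them, against Banach–Steinhaus. -/
theorem exists_norm_le_near_zero [CompleteSpace Y] (hS : IsC0Semigroup S) :
    ∃ δ > 0, ∃ M : ℝ, ∀ t, 0 ≤ t → t ≤ δ → ‖S t‖ ≤ M := by
  by_contra! hcon
  have hpos : ∀ n : ℕ, (0 : ℝ) < 1 / (n + 1) := fun n => Nat.one_div_pos_of_nat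
  -- The summand `‖S 0‖` in the threshold rules out `τ n = 0`, so that the right-sided limit
  -- applies.
  choose τ hτ0 hτ1 hτ using fun n : ℕ => hcon (1 / (n + 1)) (hpos n) (n + ‖S 0‖)
  have hτpos : ∀ n, 0 < τ n := by
    intro n
    refine lt_of_le_of_ne (hτ0 n) fun h => ?_
    have := hτ n
    rw [← h] at this
    have hn : (0 : ℝ) ≤ n := n.cast_nonneg
    linarith
  have hlim : Tendsto τ atTop (𝓝[>] 0) :=
    tendsto_nhdsWithin_iff.2 ⟨squeeze_zero hτ0 hτ1 tendsto_one_div_add_atTop_nhds_zero_nat,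
      Eventually.of_forall hτpos⟩
  obtain ⟨C, hC⟩ := banach_steinhaus (g := fun n => S (τ n)) fun x => by
    obtain ⟨C, hC⟩ := ((hS.tendsto_zero x).comp hlim).norm.bddAbove_range
    exact ⟨C, fun n => hC ⟨n, rfl⟩⟩
  obtain ⟨n, hn⟩ := exists_nat_gt C
  have h0 := norm_nonneg (S 0)
  linarith [hC n, hτ n]

theorem map_nat_mul (hS : IsC0Semigroup S) {t : ℝ} (ht : 0 ≤ t) (n : ℕ) :
    S (n * t) = S t ^ n := by
  induction n with
  | zero => simp [hS.map_zero]; rfl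
  | succ n ih =>
    rw [pow_succ', ← ih, show ((n + 1 : ℕ) : ℝ) * t = t + n * t by push_cast; ring,
      hS.map_add _ _ ht (by positivity)]
    rfl

theorem exists_norm_le_exp [CompleteSpace Y] (hS : IsC0Semigroup S) :
    ∃ M ω : ℝ, 1 ≤ M ∧ 0 ≤ ω ∧ ∀ t, 0 ≤ t → ‖S t‖ ≤ M * Real.exp (ω * t) := by
  obtain ⟨δ, hδ, M₀, hM₀⟩ := hS.exists_norm_le_near_zero
  set M := max M₀ 1
  have hM1 : 1 ≤ M := le_max_right _ _
  have hMpos : 0 < M := by linarith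
  refine ⟨M, Real.log M / δ, hM1, div_nonneg (Real.log_nonneg hM1) hδ.le, fun t ht => ?_⟩
  set n := ⌊t / δ⌋₊
  have hn : (n : ℝ) * δ ≤ t := by
    have := Nat.floor_le (div_nonneg ht hδ.le)
    rwa [le_div_iff₀ hδ] at this
  have hn' : t - n * δ ≤ δ := by
    have := Nat.lt_floor_add_one (t / δ)
    rw [div_lt_iff₀ hδ] at this
    linarith
  have hdec : S t = (S (t - n * δ)).comp (S δ ^ n) := by
    rw [← hS.map_nat_mul hδ.le, ← hS.map_add _ _ (by linarith) (by positivity)]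
    congr 1
    ring
  have hp : ‖S δ ^ n‖ ≤ M ^ n := by
    rcases Nat.eq_zero_or_pos n with h | h
    · rw [h, pow_zero, pow_zero]
      exact ContinuousLinearMap.norm_id_le
    · exact (norm_pow_le' _ h).trans
        (pow_le_pow_left₀ (norm_nonneg _) ((hM₀ δ hδ.le le_rfl).trans (le_max_left _ _)) _)
  calc ‖S t‖ ≤ ‖S (t - n * δ)‖ * ‖S δ ^ n‖ := by
        rw [hdec]; exact ContinuousLinearMap.opNorm_comp_le _ _
    _ ≤ M * M ^ n := by
        gcongr
        exact (hM₀ _ (by linarith) hn').trans (le_max_left _ _)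
    _ ≤ M * Real.exp (Real.log M / δ * t) := by
        gcongr
        rw [← Real.exp_log (pow_pos hMpos n), Real.log_pow, Real.exp_le_exp, div_mul_eq_mul_div,
          le_div_iff₀ hδ]
        nlinarith [Real.log_nonneg hM1]

/-- The semigroup extended to all real times by the identity for negative times. -/
def extend (S : ℝ → Y →L[𝕜] Y) (t : ℝ) : Y →L[𝕜] Y := S (max t 0)

theorem extend_of_nonneg {t : ℝ} (ht : 0 ≤ t) : extend S t = S t := by
  rw [extend, max_eq_left ht]

/-- Factoring out the semigroup at the smaller time reduces continuity at any time to continuity at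
`0`. -/
theorem norm_sub_le (hS : IsC0Semigroup S) {a b : ℝ} (ha : 0 ≤ a) (hb : 0 ≤ b) (x : Y) :
    ‖S a x - S b x‖ ≤ ‖S (min a b)‖ * ‖S |a - b| x - x‖ := by
  wlog h : b ≤ a generalizing a b
  · rw [norm_sub_rev, min_comm, abs_sub_comm]
    exact this hb ha (le_of_not_ge h)
  have : S a x = S b (S (a - b) x) := by
    rw [← ContinuousLinearMap.comp_apply, ← hS.map_add _ _ hb (by linarith)]
    congr 2
    ring
  rw [min_eq_right h, abs_of_nonneg (by linarith), this, ← map_sub]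
  exact ContinuousLinearMap.le_opNorm _ _

theorem tendsto_zero' (hS : IsC0Semigroup S) (x : Y) :
    Tendsto (fun t => S t x) (𝓝[≥] 0) (𝓝 x) := by
  have h : (𝓝[≥] (0 : ℝ)) = 𝓝[>] 0 ⊔ pure 0 := by
    rw [← Ioi_insert, nhdsWithin_insert, sup_comm]
  rw [h, tendsto_sup]
  refine ⟨hS.tendsto_zero x, ?_⟩
  rw [tendsto_pure_left]
  intro s hs
  simpa [hS.map_zero] using mem_of_mem_nhds hs

/-- The local bound controls the change of state, and strong continuity at `0` the change of time.
Joint continuity makes convolution integrands `S (t - s) (f s)` continuous or measurable along with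
`f`. -/
theorem continuous_extend [CompleteSpace Y] (hS : IsC0Semigroup S) :
    Continuous fun p : ℝ × Y => extend S p.1 p.2 := by
  obtain ⟨M, ω, hM, hω, hb⟩ := hS.exists_norm_le_exp
  rw [continuous_iff_continuousAt]
  rintro ⟨t, x⟩
  rw [ContinuousAt, tendsto_iff_norm_sub_tendsto_zero]
  have hlim : Tendsto (fun p : ℝ × Y => M * Real.exp (ω * max p.1 0) * ‖p.2 - x‖ +
      M * Real.exp (ω * max t 0) * ‖S |max p.1 0 - max t 0| x - x‖) (𝓝 (t, x))
      (𝓝 (M * Real.exp (ω * max t 0) * ‖x - x‖ + M * Real.exp (ω * max t 0) * ‖x - x‖)) := by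
    refine Tendsto.add ?_ ?_
    · exact (show Continuous fun p : ℝ × Y => M * Real.exp (ω * max p.1 0) * ‖p.2 - x‖ by
        fun_prop).tendsto (t, x)
    · refine tendsto_const_nhds.mul (Tendsto.norm (Tendsto.sub ?_ tendsto_const_nhds))
      refine (hS.tendsto_zero' x).comp (tendsto_nhdsWithin_iff.2 ⟨?_, ?_⟩)
      · have : Continuous fun p : ℝ × Y => |max p.1 0 - max t 0| := by fun_prop
        simpa using this.tendsto (t, x)
      · exact Eventually.of_forall fun p => mem_Ici.2 (abs_nonneg _)
  simp only [sub_self, norm_zero, mul_zero, add_zero] at hlim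
  refine squeeze_zero (fun _ => norm_nonneg _) (fun p => ?_) hlim
  have h1 : extend S p.1 p.2 - extend S t x
      = extend S p.1 (p.2 - x) + (S (max p.1 0) x - S (max t 0) x) := by
    simp [extend]
  rw [h1]
  refine (norm_add_le _ _).trans (add_le_add ?_ ?_)
  · exact (ContinuousLinearMap.le_opNorm _ _).trans
      (mul_le_mul_of_nonneg_right (hb _ (le_max_right _ _)) (norm_nonneg _))
  · refine (hS.norm_sub_le (le_max_right _ _) (le_max_right _ _) x).trans
      (mul_le_mul_of_nonneg_right ((hb _ (le_min (le_max_right _ _) (le_max_right _ _))).trans ?_)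
        (norm_nonneg _))
    gcongr
    exact min_le_right _ _

theorem continuous_extend_comp [CompleteSpace Y] (hS : IsC0Semigroup S) {X : Type*}
    [TopologicalSpace X] {f : X → ℝ} {g : X → Y} (hf : Continuous f) (hg : Continuous g) :
    Continuous fun x => extend S (f x) (g x) :=
  hS.continuous_extend.comp (hf.prodMk hg)

theorem extend_add (hS : IsC0Semigroup S) {s t : ℝ} (hs : 0 ≤ s) (ht : 0 ≤ t) (x : Y) :
    extend S (s + t) x = extend S s (extend S t x) := by
  rw [extend_of_nonneg hs, extend_of_nonneg ht, extend_of_nonneg (add_nonneg hs ht),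
    hS.map_add _ _ hs ht]
  rfl

theorem extend_zero (hS : IsC0Semigroup S) (x : Y) : extend S 0 x = x := by
  simp [extend, hS.map_zero]

theorem exists_norm_extend_le [CompleteSpace Y] (hS : IsC0Semigroup S) (T : ℝ) :
    ∃ M, 0 < M ∧ ∀ t ≤ T, ‖extend S t‖ ≤ M := by
  obtain ⟨M, ω, hM, hω, hb⟩ := hS.exists_norm_le_exp
  refine ⟨M * Real.exp (ω * max T 0), by positivity, fun t ht => (hb _ (le_max_right _ _)).trans ?_⟩
  gcongr

theorem aestronglyMeasurable_extend [CompleteSpace Y] (hS : IsC0Semigroup S) {f : ℝ → Y}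
    {μ : Measure ℝ} (hf : AEStronglyMeasurable f μ) (t : ℝ) :
    AEStronglyMeasurable (fun s => extend S (t - s) (f s)) μ :=
  hS.continuous_extend.comp_aestronglyMeasurable
    (((continuous_const.sub continuous_id).aestronglyMeasurable).prodMk hf)

theorem integrableOn_extend [CompleteSpace Y] (hS : IsC0Semigroup S) {f : ℝ → Y} {a b : ℝ}
    (hf : IntegrableOn f (Ioc a b)) (t : ℝ) :
    IntegrableOn (fun s => extend S (t - s) (f s)) (Ioc a b) := by
  obtain ⟨M, hM, hb⟩ := hS.exists_norm_extend_le (t - a)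
  refine Integrable.mono' (hf.norm.const_mul M) (hS.aestronglyMeasurable_extend hf.1 t) ?_
  refine (ae_restrict_iff' measurableSet_Ioc).2 (Eventually.of_forall fun s hs => ?_)
  exact (ContinuousLinearMap.le_opNorm _ _).trans
    (mul_le_mul_of_nonneg_right (hb _ (by linarith [hs.1])) (norm_nonneg _))

end IsC0Semigroup

/-! ### Mild solutions: linearity, time translation, uniqueness. -/

section Mild

variable {𝕜 Y U : Type*} [RCLike 𝕜] [NormedAddCommGroup Y] [InnerProductSpace 𝕜 Y]
  [NormedSpace ℝ Y] [NormedAddCommGroup U] [InnerProductSpace 𝕜 U]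
  {S : ℝ → Y →L[𝕜] Y} {B : U →L[𝕜] Y} {u v : ℝ → U} {y z : ℝ → Y} {y₀ z₀ : Y}

/-- `y` is the mild solution of `y' = A y + B u`, `y(0) = y₀`, where `S` is generated by `A`. -/
def IsMild (S : ℝ → Y →L[𝕜] Y) (B : U →L[𝕜] Y) (u : ℝ → U) (y₀ : Y) (y : ℝ → Y) : Prop :=
  ContinuousOn y (Ici 0) ∧
    ∀ t : ℝ, 0 ≤ t → IntegrableOn u (Ioc 0 t) ∧
      y t = IsC0Semigroup.extend S t y₀ +
        ∫ s in (0 : ℝ)..t, IsC0Semigroup.extend S (t - s) (B (u s))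

open IsC0Semigroup (extend extend_of_nonneg)

theorem IsC0Semigroup.intervalIntegrable_extend [CompleteSpace Y] (hS : IsC0Semigroup S)
    (B : U →L[𝕜] Y) {a b : ℝ} (hab : a ≤ b) (hu : IntegrableOn u (Ioc a b)) (t : ℝ) :
    IntervalIntegrable (fun s => extend S (t - s) (B (u s))) volume a b := by
  rw [intervalIntegrable_iff_integrableOn_Ioc_of_le hab]
  exact hS.integrableOn_extend (B.integrable_comp hu) t

namespace IsMild

theorem apply_zero (hS : IsC0Semigroup S) (h : IsMild S B u y₀ y) : y 0 = y₀ := by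
  rw [(h.2 0 le_rfl).2, intervalIntegral.integral_same, add_zero, hS.extend_zero]

theorem congr_ae (h : IsMild S B u y₀ y) (huv : ∀ᵐ t, 0 < t → u t = v t) :
    IsMild S B v y₀ y := by
  refine ⟨h.1, fun t ht => ⟨(h.2 t ht).1.congr_fun_ae ?_, (h.2 t ht).2.trans ?_⟩⟩
  · filter_upwards [ae_restrict_of_ae huv, ae_restrict_mem measurableSet_Ioc] with s hs hs'
    exact hs hs'.1
  · congr 1
    refine intervalIntegral.integral_congr_ae ?_
    filter_upwards [huv] with s hs hs'
    rw [uIoc_of_le ht] at hs'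
    rw [hs hs'.1]

variable [CompleteSpace Y]

theorem zero : IsMild S B (0 : ℝ → U) 0 (0 : ℝ → Y) :=
  ⟨continuousOn_const, fun t _ => ⟨integrableOn_zero, by simp⟩⟩

theorem add (hS : IsC0Semigroup S) (h : IsMild S B u y₀ y) (h' : IsMild S B v z₀ z) :
    IsMild S B (u + v) (y₀ + z₀) (y + z) := by
  refine ⟨h.1.add h'.1, fun t ht => ⟨(h.2 t ht).1.add (h'.2 t ht).1, ?_⟩⟩
  have h1 := hS.intervalIntegrable_extend B ht (h.2 t ht).1 t
  have h2 := hS.intervalIntegrable_extend B ht (h'.2 t ht).1 t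
  simp only [Pi.add_apply, map_add, intervalIntegral.integral_add h1 h2]
  rw [(h.2 t ht).2, (h'.2 t ht).2]
  abel

theorem smul (hS : IsC0Semigroup S) (c : 𝕜) (h : IsMild S B u y₀ y) :
    IsMild S B (c • u) (c • y₀) (c • y) := by
  refine ⟨h.1.const_smul c, fun t ht => ⟨(h.2 t ht).1.smul c, ?_⟩⟩
  have h1 := hS.intervalIntegrable_extend B ht (h.2 t ht).1 t
  have h2 := ((c • ContinuousLinearMap.id 𝕜 Y).intervalIntegral_comp_comm h1)
  simp only [smul_apply, ContinuousLinearMap.id_apply] at h2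
  simp only [Pi.smul_apply, map_smul, h2]
  rw [(h.2 t ht).2, smul_add]

theorem sub (hS : IsC0Semigroup S) (h : IsMild S B u y₀ y) (h' : IsMild S B v z₀ z) :
    IsMild S B (u - v) (y₀ - z₀) (y - z) := by
  have := h.add hS (h'.smul hS (-1))
  simpa [sub_eq_add_neg] using this

theorem shift (hS : IsC0Semigroup S) (h : IsMild S B u y₀ y) {r : ℝ} (hr : 0 ≤ r) :
    IsMild S B (fun t => u (t + r)) (y r) (fun t => y (t + r)) := by
  refine ⟨h.1.comp (by fun_prop) fun t ht => ?_, fun t ht => ⟨?_, ?_⟩⟩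
  · exact add_nonneg ht hr
  · have h1 : IntegrableOn u (Ioc r (t + r)) :=
      (h.2 (t + r) (by positivity)).1.mono_set (Ioc_subset_Ioc_left hr)
    rw [← intervalIntegrable_iff_integrableOn_Ioc_of_le (by linarith)] at h1
    have h2 := h1.comp_add_right r
    simp only [sub_self, add_sub_cancel_right] at h2
    rwa [intervalIntegrable_iff_integrableOn_Ioc_of_le ht] at h2
  · have hur := (h.2 (t + r) (by positivity)).1
    have h0 := hS.intervalIntegrable_extend B hr (h.2 r hr).1 (t + r)
    have h1 := hS.intervalIntegrable_extend B (by linarith : r ≤ t + r)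
      (hur.mono_set (Ioc_subset_Ioc_left hr)) (t + r)
    have h2 := hS.intervalIntegrable_extend B hr (h.2 r hr).1 r
    simp only
    rw [(h.2 (t + r) (by positivity)).2, (h.2 r hr).2, map_add, hS.extend_add ht hr, add_assoc,
      ← intervalIntegral.integral_add_adjacent_intervals h0 h1,
      ← (extend S t).intervalIntegral_comp_comm h2]
    congr 2
    · refine intervalIntegral.integral_congr fun s hs => ?_
      rw [uIcc_of_le hr] at hs
      rw [← hS.extend_add ht (by linarith [hs.2])]
      congr 2
      ring
    · have := intervalIntegral.integral_comp_add_right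
        (fun s => extend S (t + r - s) (B (u s))) (a := 0) (b := t) r
      rw [zero_add] at this
      rw [← this]
      refine intervalIntegral.integral_congr fun s hs => ?_
      congr 2
      ring

theorem norm_sub_le {M h t : ℝ} (hM : ∀ s ≤ h, ‖extend S s‖ ≤ M)
    (hy : IsMild S B u y₀ y) (ht : 0 ≤ t) (hth : t ≤ h) :
    ‖y t - extend S t y₀‖ ≤ M * ‖B‖ * ∫ s in (0 : ℝ)..t, ‖u s‖ := by
  rw [(hy.2 t ht).2, add_sub_cancel_left, ← intervalIntegral.integral_const_mul]
  refine intervalIntegral.norm_integral_le_of_norm_le ht ?_ ?_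
  · refine Eventually.of_forall fun s hs => ?_
    rw [mul_assoc]
    exact (ContinuousLinearMap.le_opNorm _ _).trans (mul_le_mul (hM _ (by linarith [hs.1]))
      (B.le_opNorm _) (norm_nonneg _) ((norm_nonneg _).trans (hM _ (by linarith [hs.1]))))
  · rw [intervalIntegrable_iff_integrableOn_Ioc_of_le ht]
    exact (hy.2 t ht).1.norm.const_mul _

/-- Gronwall is applied to `φ s = ∫₀ˢ ‖y‖`, since `y` itself need not be differentiable: `φ 0 = 0`
and `φ' = ‖y‖ ≤ M ‖B‖ K φ` force `φ = 0`. Uniqueness for closed loops with constant gain follows by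
taking differences. -/
theorem eq_zero_of_norm_le (hS : IsC0Semigroup S) (h : IsMild S B u 0 y) {K : ℝ}
    (hu : ∀ t, 0 ≤ t → ‖u t‖ ≤ K * ‖y t‖) {t : ℝ} (ht : 0 ≤ t) : y t = 0 := by
  obtain ⟨M, hM, hb⟩ := hS.exists_norm_extend_le t
  -- Freezing `y` at negative times makes `d` continuous on all of `ℝ`, so its primitive has
  -- two-sided derivatives.
  set d : ℝ → ℝ := fun s => ‖y (max s 0)‖
  have hd : Continuous d :=
    (h.1.comp_continuous (f := fun s : ℝ => max s 0) (by fun_prop) fun s => mem_Ici.2 (le_max_right _ _)).norm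
  have hdy : ∀ s, 0 ≤ s → d s = ‖y s‖ := fun s hs => by simp only [d, max_eq_left hs]
  have key : ∀ s, 0 ≤ s → s ≤ t → d s ≤ M * ‖B‖ * K * ∫ r in (0 : ℝ)..s, d r := by
    intro s hs hst
    have h1 := norm_sub_le hb h hs hst
    rw [map_zero, sub_zero] at h1
    rw [hdy s hs, mul_assoc (M * ‖B‖), ← intervalIntegral.integral_const_mul]
    refine h1.trans (mul_le_mul_of_nonneg_left ?_ (by positivity))
    refine intervalIntegral.integral_mono_on hs ?_ ((hd.intervalIntegrable 0 s).const_mul K) ?_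
    · rw [intervalIntegrable_iff_integrableOn_Ioc_of_le hs]
      exact (h.2 s hs).1.norm
    · intro r hr
      rw [hdy r hr.1]
      exact hu r hr.1
  have hφ : ∀ s ∈ Icc 0 t, ‖∫ r in (0 : ℝ)..s, d r‖ ≤
      gronwallBound 0 (M * ‖B‖ * K) 0 (s - 0) := by
    have hder : ∀ s, HasDerivAt (fun s => ∫ r in (0 : ℝ)..s, d r) (d s) s := fun s =>
      (hd.integral_hasStrictDerivAt 0 s).hasDerivAt
    refine norm_le_gronwallBound_of_norm_deriv_right_le (f' := d)
      (fun s _ => (hder s).continuousAt.continuousWithinAt) (fun s _ => (hder s).hasDerivWithinAt)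
      (by simp) fun s hs => ?_
    have h0 : 0 ≤ ∫ r in (0 : ℝ)..s, d r :=
      intervalIntegral.integral_nonneg hs.1 fun r _ => norm_nonneg _
    rw [Real.norm_of_nonneg h0, Real.norm_of_nonneg (norm_nonneg _), add_zero]
    exact key s hs.1 hs.2.le
  have h1 := hφ t ⟨ht, le_rfl⟩
  have h2 : gronwallBound 0 (M * ‖B‖ * K) 0 (t - 0) = 0 := by
    rw [gronwallBound_ε0, zero_mul]
  rw [h2, norm_le_zero_iff] at h1
  have h3 := key t ht le_rfl
  rw [h1, mul_zero, hdy t ht] at h3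
  exact norm_le_zero_iff.1 h3

end IsMild

theorem ControlSystem.isSolution_iff (sys : ControlSystem 𝕜 Y U) (u : ℝ → U) (y₀ : Y)
    (y : ℝ → Y) :
    letI : NormedSpace ℝ Y := NormedSpace.restrictScalars ℝ 𝕜 Y
    sys.IsSolution u y₀ y ↔ IsMild sys.S sys.B u y₀ y := by
  let : NormedSpace ℝ Y := NormedSpace.restrictScalars ℝ 𝕜 Y
  refine and_congr_right fun _ => forall_congr' fun t => forall_congr' fun ht =>
    and_congr_right fun _ => ?_
  have : (∫ s in (0 : ℝ)..t, sys.S (t - s) (sys.B (u s))) =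
      ∫ s in (0 : ℝ)..t, extend sys.S (t - s) (sys.B (u s)) := by
    refine intervalIntegral.integral_congr fun s hs => ?_
    rw [uIcc_of_le ht] at hs
    rw [extend_of_nonneg (by linarith [hs.2])]
  rw [← this, extend_of_nonneg ht]

end Mild

/-! ### Bounded perturbations through a Volterra equation. -/

theorem integral_exp_neg_mul_sub_le {κ τ : ℝ} (hκ : 0 < κ) :
    ∫ s in (0 : ℝ)..τ, Real.exp (-(κ * (τ - s))) ≤ 1 / κ := by
  have hd : ∀ s ∈ uIcc 0 τ, HasDerivAt (fun s => Real.exp (-(κ * (τ - s))) / κ)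
      (Real.exp (-(κ * (τ - s)))) s := by
    intro s _
    have h1 : HasDerivAt (fun s => -(κ * (τ - s))) κ s := by
      exact (((hasDerivAt_id s).const_sub τ).const_mul κ).fun_neg.congr_deriv (by ring)
    have := h1.exp.div_const κ
    rwa [mul_div_cancel_right₀ _ hκ.ne'] at this
  rw [intervalIntegral.integral_eq_sub_of_hasDerivAt hd
    (Continuous.intervalIntegrable (by fun_prop) _ _)]
  simp only [sub_self, mul_zero, neg_zero, Real.exp_zero]
  have : 0 ≤ Real.exp (-(κ * (τ - 0))) / κ := by positivity
  linarith

section Volterra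

variable {𝕜 Y U : Type*} [RCLike 𝕜] [NormedAddCommGroup Y] [InnerProductSpace 𝕜 Y]
  [NormedSpace ℝ Y] [CompleteSpace Y]

/-- On bounded continuous functions the Volterra operator `V` has norm at most `M ‖K‖ / κ ≤ 1/2`, so
`1 - V` is invertible. Applying the inverse to the orbit map `G` and evaluating at `t` gives
linearity and boundedness in `x` at no extra cost. -/
theorem exists_volterra_solution {R : ℝ → Y →L[𝕜] Y} {K : Y →L[𝕜] Y} {M κ : ℝ}
    (hR : Continuous fun p : ℝ × Y => R p.1 p.2) (hκ : 0 < κ)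
    (hb : ∀ t, 0 ≤ t → ‖R t‖ ≤ M * Real.exp (-(κ * t))) (hM : M * ‖K‖ ≤ κ / 2) :
    ∃ Z : ℝ → Y →L[𝕜] Y, ∀ x, Continuous (fun t => Z t x) ∧
      ∀ t, 0 ≤ t → Z t x = R t x + ∫ s in (0 : ℝ)..t, R (t - s) (K (Z s x)) := by
  have hRc : ∀ {X : Type} [TopologicalSpace X] {f : X → ℝ} {g : X → Y}, Continuous f →
      Continuous g → Continuous fun x => R (f x) (g x) := fun hf hg => hR.comp (hf.prodMk hg)
  have hM0 : 0 ≤ M := by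
    have := (norm_nonneg _).trans (hb 0 le_rfl)
    simpa using this
  have hint : ∀ (z : ℝ → Y) (_ : Continuous z) (t : ℝ),
      Continuous fun s => R (t - s) (K (z s)) := fun z hz t =>
    hRc (by fun_prop) (K.continuous.comp hz)
  have hbV : ∀ (z : ℝ →ᵇ Y) (τ : ℝ), 0 ≤ τ →
      ‖∫ s in (0 : ℝ)..τ, R (τ - s) (K (z s))‖ ≤ 1 / 2 * ‖z‖ := by
    intro z τ hτ
    have h1 : ‖∫ s in (0 : ℝ)..τ, R (τ - s) (K (z s))‖ ≤
        ∫ s in (0 : ℝ)..τ, (M * ‖K‖ * ‖z‖) * Real.exp (-(κ * (τ - s))) := by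
      refine intervalIntegral.norm_integral_le_of_norm_le hτ
        (Eventually.of_forall fun s hs => ?_) (Continuous.intervalIntegrable (by fun_prop) _ _)
      calc ‖R (τ - s) (K (z s))‖ ≤ ‖R (τ - s)‖ * (‖K‖ * ‖z‖) :=
            (ContinuousLinearMap.le_opNorm _ _).trans (mul_le_mul_of_nonneg_left
              ((K.le_opNorm _).trans
                (mul_le_mul_of_nonneg_left (z.norm_coe_le_norm s) (norm_nonneg _)))
              (norm_nonneg _))
        _ ≤ M * Real.exp (-(κ * (τ - s))) * (‖K‖ * ‖z‖) :=
            mul_le_mul_of_nonneg_right (hb _ (by linarith [hs.2])) (by positivity)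
        _ = _ := by ring
    rw [intervalIntegral.integral_const_mul] at h1
    calc _ ≤ _ := h1
      _ ≤ M * ‖K‖ * ‖z‖ * (1 / κ) := by
          gcongr
          exact integral_exp_neg_mul_sub_le hκ
      _ ≤ κ / 2 * ‖z‖ * (1 / κ) := by gcongr
      _ = 1 / 2 * ‖z‖ := by field_simp
  have hbR : ∀ (x : Y) (t : ℝ), ‖R (max t 0) x‖ ≤ M * ‖x‖ := fun x t =>
    (ContinuousLinearMap.le_opNorm _ _).trans (mul_le_mul_of_nonneg_right
      ((hb _ (le_max_right _ _)).trans (mul_le_of_le_one_right hM0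
        (Real.exp_le_one_iff.2 (neg_nonpos.2 (mul_nonneg hκ.le (le_max_right _ _))))))
      (norm_nonneg _))
  let V : (ℝ →ᵇ Y) →L[𝕜] (ℝ →ᵇ Y) := LinearMap.mkContinuous
    { toFun := fun z => BoundedContinuousFunction.ofNormedAddCommGroup
        (fun t => ∫ s in (0 : ℝ)..max t 0, R (max t 0 - s) (K (z s)))
        (intervalIntegral.continuous_parametric_intervalIntegral_of_continuous
          (hRc (f := fun p : ℝ × ℝ => max p.1 0 - p.2) (g := fun p : ℝ × ℝ => K (z p.2))
            (by fun_prop) (by fun_prop)) (by fun_prop))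
        (1 / 2 * ‖z‖) (fun t => hbV z _ (le_max_right _ _))
      map_add' := fun z w => by
        ext t
        simp only [BoundedContinuousFunction.coe_ofNormedAddCommGroup,
          BoundedContinuousFunction.coe_add, Pi.add_apply, map_add]
        exact intervalIntegral.integral_add ((hint z z.continuous _).intervalIntegrable _ _)
          ((hint w w.continuous _).intervalIntegrable _ _)
      map_smul' := fun c z => by
        ext t
        simp only [BoundedContinuousFunction.coe_ofNormedAddCommGroup,
          BoundedContinuousFunction.coe_smul, map_smul, RingHom.id_apply]
        exact (c • ContinuousLinearMap.id 𝕜 Y).intervalIntegral_comp_comm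
          ((hint z z.continuous (max t 0)).intervalIntegrable _ _) }
    (1 / 2) (fun z => BoundedContinuousFunction.norm_ofNormedAddCommGroup_le _ (by positivity)
      (fun t => hbV z _ (le_max_right _ _)))
  let G : Y →L[𝕜] (ℝ →ᵇ Y) := LinearMap.mkContinuous
    { toFun := fun x => BoundedContinuousFunction.ofNormedAddCommGroup
        (fun t => R (max t 0) x) (hRc (by fun_prop) continuous_const) (M * ‖x‖)
        (fun t => hbR x t)
      map_add' := fun x y => by ext t; simp
      map_smul' := fun c x => by ext t; simp }
    M (fun x => BoundedContinuousFunction.norm_ofNormedAddCommGroup_le _ (by positivity) (hbR x))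
  have hV : ‖V‖ < 1 :=
    (LinearMap.mkContinuous_norm_le _ (by norm_num) _).trans_lt (by norm_num)
  let J : (ℝ →ᵇ Y) →L[𝕜] (ℝ →ᵇ Y) := ((Units.oneSub V hV)⁻¹ : Units _).val
  have hJ : ∀ z, J z = z + V (J z) := by
    intro z
    have h1 : (1 - V) * J = 1 := (Units.oneSub V hV).mul_inv
    have h2 := DFunLike.congr_fun h1 z
    change J z - V (J z) = z at h2
    exact sub_eq_iff_eq_add.1 h2
  refine ⟨fun t => (BoundedContinuousFunction.evalCLM 𝕜 t).comp (J.comp G), fun x =>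
    ⟨(J (G x)).continuous, fun t ht => ?_⟩⟩
  have h1 := DFunLike.congr_fun (hJ (G x)) t
  have h2 : G x t = R (max t 0) x := rfl
  have h3 : V (J (G x)) t =
    ∫ s in (0 : ℝ)..max t 0, R (max t 0 - s) (K (J (G x) s)) := rfl
  rw [BoundedContinuousFunction.add_apply, h2, h3, max_eq_left ht] at h1
  exact h1

open IsC0Semigroup (extend extend_of_nonneg)

/-- Bounded perturbation: the solution operators of `y' = (A + K) y`. -/
theorem IsC0Semigroup.exists_perturbation {S : ℝ → Y →L[𝕜] Y} (hS : IsC0Semigroup S)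
    (K : Y →L[𝕜] Y) :
    ∃ Z : ℝ → Y →L[𝕜] Y, ∀ x, Continuous (fun t => Z t x) ∧
      ∀ t, 0 ≤ t → Z t x = extend S t x + ∫ s in (0 : ℝ)..t, extend S (t - s) (K (Z s x)) := by
  obtain ⟨M, ω, hM, hω, hb⟩ := hS.exists_norm_le_exp
  -- Weighting by `e^{-(ω+κ)t}` turns the growth bound into decay at rate `κ`, and this `κ`
  -- satisfies `M ‖K‖ ≤ κ / 2`. The weight is undone at the end.
  set κ := 2 * (M * ‖K‖) + 1
  have hκ : 0 < κ := by positivity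
  set e : ℝ → 𝕜 := fun t => ((Real.exp ((ω + κ) * t) : ℝ) : 𝕜)
  set e' : ℝ → 𝕜 := fun t => ((Real.exp (-((ω + κ) * t)) : ℝ) : 𝕜)
  have he : Continuous e := RCLike.continuous_ofReal.comp (by fun_prop)
  have he' : Continuous e' := RCLike.continuous_ofReal.comp (by fun_prop)
  have hee : ∀ t s, e t * e' (t - s) = e s := by
    intro t s
    simp only [e, e', ← RCLike.ofReal_mul, ← Real.exp_add]
    congr 2
    ring
  obtain ⟨Z, hZ⟩ := exists_volterra_solution (R := fun t => e' t • extend S t) (K := K) (M := M)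
    (κ := κ) ((he'.comp continuous_fst).smul hS.continuous_extend) hκ (fun t ht => by
      rw [norm_smul, extend_of_nonneg ht]
      simp only [e', RCLike.norm_ofReal, abs_of_pos (Real.exp_pos _)]
      calc _ ≤ Real.exp (-((ω + κ) * t)) * (M * Real.exp (ω * t)) := by
            gcongr
            exact hb t ht
        _ = M * Real.exp (-(κ * t)) := by
            rw [mul_left_comm, ← Real.exp_add]
            congr 2
            ring) (by simp only [κ]; linarith)
  refine ⟨fun t => e t • Z t, fun x => ⟨he.smul (hZ x).1, fun t ht => ?_⟩⟩
  have hc : Continuous fun s => e' (t - s) • extend S (t - s) (K (Z s x)) :=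
    (he'.comp (by fun_prop)).smul
      (hS.continuous_extend_comp (by fun_prop) (K.continuous.comp (hZ x).1))
  have h1 := (e t • ContinuousLinearMap.id 𝕜 Y).intervalIntegral_comp_comm
    (hc.intervalIntegrable (μ := volume) 0 t)
  simp only [smul_apply, ContinuousLinearMap.id_apply, smul_smul, hee] at h1
  have h0 := hee t 0
  rw [sub_zero] at h0
  simp only [smul_apply, (hZ x).2 t ht, smul_add, smul_smul, h0, ← h1, map_smul]
  simp [e]

theorem IsC0Semigroup.exists_closedLoop [NormedAddCommGroup U] [InnerProductSpace 𝕜 U]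
    {S : ℝ → Y →L[𝕜] Y} (hS : IsC0Semigroup S) (B : U →L[𝕜] Y) (F : Y →L[𝕜] U) :
    ∃ Z : ℝ → Y →L[𝕜] Y, ∀ x, Continuous (fun t => Z t x) ∧
      IsMild S B (fun t => F (Z t x)) x (fun t => Z t x) := by
  obtain ⟨Z, hZ⟩ := hS.exists_perturbation (B.comp F)
  exact ⟨Z, fun x => ⟨(hZ x).1, (hZ x).1.continuousOn, fun t ht =>
    ⟨((F.continuous.comp (hZ x).1).integrableOn_Icc).mono_set Ioc_subset_Icc_self,
      (hZ x).2 t ht⟩⟩⟩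

theorem IsMild.eq_closedLoop [NormedAddCommGroup U] [InnerProductSpace 𝕜 U]
    {S : ℝ → Y →L[𝕜] Y} (hS : IsC0Semigroup S) {B : U →L[𝕜] Y} {F : Y →L[𝕜] U} {x : Y}
    {y z : ℝ → Y} (hy : IsMild S B (fun t => F (y t)) x y)
    (hz : IsMild S B (fun t => F (z t)) x z) {t : ℝ} (ht : 0 ≤ t) : y t = z t := by
  have h := hy.sub hS hz
  rw [sub_self] at h
  refine sub_eq_zero.1 (h.eq_zero_of_norm_le hS (K := ‖F‖) (fun t _ => ?_) ht)
  simp only [Pi.sub_apply, ← map_sub]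
  exact F.le_opNorm _

end Volterra

/-! ### From constant continuous feedback to periodic sampled feedback; bounds for periodic gains.
-/

section Feedback

variable {𝕜 Y U : Type*} [RCLike 𝕜] [NormedAddCommGroup Y] [InnerProductSpace 𝕜 Y]
  [CompleteSpace Y] [NormedAddCommGroup U] [InnerProductSpace 𝕜 U]

section

variable [NormedSpace ℝ Y]

theorem IsMild.closedLoop_add {S : ℝ → Y →L[𝕜] Y} (hS : IsC0Semigroup S) {B : U →L[𝕜] Y}
    {F : Y →L[𝕜] U} {Z : ℝ → Y →L[𝕜] Y}
    (hZ : ∀ x, IsMild S B (fun t => F (Z t x)) x (fun t => Z t x)) {s t : ℝ} (hs : 0 ≤ s)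
    (ht : 0 ≤ t) (x : Y) : Z (s + t) x = Z s (Z t x) :=
  ((hZ x).shift hS ht).eq_closedLoop hS (hZ (Z t x)) hs

end

namespace ControlSystem

theorem ccStabilizable_of_closedLoop (sys : ControlSystem 𝕜 Y U) {F : Y →L[𝕜] U}
    {Z : ℝ → Y →L[𝕜] Y} {C ω : ℝ} (hC : 0 < C) (hω : 0 < ω)
    (hZ : ∀ x, sys.IsSolution (fun t => F (Z t x)) x (fun t => Z t x))
    (hdecay : ∀ t, 0 ≤ t → ‖Z t‖ ≤ C * Real.exp (-(ω * t))) : sys.CCStabilizable := by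
  let : NormedSpace ℝ Y := NormedSpace.restrictScalars ℝ 𝕜 Y
  refine ⟨F, C, hC, ω, hω, fun x => ⟨⟨_, hZ x⟩, fun y hy t ht => ?_⟩⟩
  rw [((sys.isSolution_iff _ _ _).1 hy).eq_closedLoop sys.isC0Semigroup
    ((sys.isSolution_iff _ _ _).1 (hZ x)) ht]
  exact (ContinuousLinearMap.le_opNorm _ _).trans
    (mul_le_mul_of_nonneg_right (hdecay t ht) (norm_nonneg _))

theorem CCStabilizable.cpStabilizable {sys : ControlSystem 𝕜 Y U} (h : sys.CCStabilizable)
    (T : ℝ) : sys.CPStabilizable T := by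
  obtain ⟨F, hF⟩ := h
  exact ⟨fun _ => F, ⟨fun y => aestronglyMeasurable_const,
    fun K _ _ => ⟨‖F‖, Eventually.of_forall fun _ => le_rfl⟩,
    Eventually.of_forall fun _ => rfl⟩, hF⟩

theorem DCStabilizable.dpStabilizable {sys : ControlSystem 𝕜 Y U} {T : ℝ}
    (h : sys.DCStabilizable T) : sys.DPStabilizable T := by
  obtain ⟨F, hF⟩ := h
  exact ⟨fun _ => F, ⟨fun y => aestronglyMeasurable_const,
    fun K _ _ => ⟨‖F‖, Eventually.of_forall fun _ => le_rfl⟩,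
    Eventually.of_forall fun _ => rfl⟩, hF⟩

/-- The gain predicts the present state from the last sample by running the closed-loop semigroup
for the time elapsed since then, and applies `F` to the prediction. The elapsed time is periodic in
`t`. -/
theorem CCStabilizable.dpStabilizable {sys : ControlSystem 𝕜 Y U} (h : sys.CCStabilizable)
    {T : ℝ} (hT : 0 < T) : sys.DPStabilizable T := by
  let : NormedSpace ℝ Y := NormedSpace.restrictScalars ℝ 𝕜 Y
  obtain ⟨F, C, hC, ω, hω, hF⟩ := h
  have hS := sys.isC0Semigroup
  obtain ⟨Z, hZ⟩ := hS.exists_closedLoop sys.B F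
  have hZb : ∀ x t, 0 ≤ t → ‖Z t x‖ ≤ C * Real.exp (-(ω * t)) * ‖x‖ := fun x t ht =>
    (hF x).2 _ ((sys.isSolution_iff _ _ _).2 (hZ x).2) t ht
  have hfl : ∀ t, 0 ≤ t → (⌊t / T⌋₊ : ℝ) * T ≤ t := fun t ht =>
    (le_div_iff₀ hT).1 (Nat.floor_le (div_nonneg ht hT.le))
  set G : ℝ → Y →L[𝕜] U := fun t => F.comp (Z (t - (⌊t / T⌋₊ : ℝ) * T))
  have hG : ∀ x t, 0 ≤ t → G t (sampling T (fun s => Z s x) t) = F (Z t x) := by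
    intro x t ht
    simp only [G, sampling, ContinuousLinearMap.comp_apply]
    rw [← IsMild.closedLoop_add hS (fun x => (hZ x).2) (by linarith [hfl t ht]) (by positivity),
      sub_add_cancel]
  have hsol : ∀ x, IsMild sys.S sys.B (fun t => G t (sampling T (fun s => Z s x) t)) x
      (fun s => Z s x) := fun x =>
    (hZ x).2.congr_ae (Eventually.of_forall fun t ht => (hG x t ht.le).symm)
  refine ⟨G, ⟨fun y => ?_, fun K hKc hK => ⟨‖F‖ * C, ?_⟩, ?_⟩, C, hC, ω, hω, fun x =>
    ⟨⟨_, (sys.isSolution_iff _ _ _).2 (hsol x)⟩, fun y hy t ht => ?_⟩⟩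
  · refine StronglyMeasurable.aestronglyMeasurable ?_
    refine ((F.continuous.comp (hZ y).1).stronglyMeasurable.comp_measurable
      (g := fun t : ℝ => t - (⌊t / T⌋₊ : ℝ) * T) ?_)
    have : Measurable fun t : ℝ => (⌊t / T⌋₊ : ℝ) :=
      measurable_from_nat.comp (Nat.measurable_floor.comp (measurable_id.div_const T))
    exact measurable_id.sub (this.mul_const T)
  · refine ae_restrict_of_forall_mem hKc.measurableSet fun t ht => ?_
    have ht0 : 0 ≤ t - (⌊t / T⌋₊ : ℝ) * T := by linarith [hfl t (le_of_lt (hK ht))]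
    refine ContinuousLinearMap.opNorm_le_bound _ (by positivity) fun x => ?_
    rw [mul_assoc]
    refine (F.le_opNorm _).trans (mul_le_mul_of_nonneg_left ((hZb x _ ht0).trans ?_)
      (norm_nonneg _))
    refine mul_le_mul_of_nonneg_right (mul_le_of_le_one_right hC.le ?_) (norm_nonneg _)
    exact Real.exp_le_one_iff.2 (neg_nonpos.2 (mul_nonneg hω.le ht0))
  · refine (ae_restrict_iff' measurableSet_Ioi).2 (Eventually.of_forall fun t ht => ?_)
    have h1 : ⌊(t + T) / T⌋₊ = ⌊t / T⌋₊ + 1 := by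
      rw [add_div, div_self hT.ne', Nat.floor_add_one (div_nonneg (le_of_lt ht) hT.le)]
    simp only [G, h1]
    congr 2
    push_cast
    ring
  · have hy' := ((sys.isSolution_iff _ _ _).1 hy).sub hS (hsol x)
    rw [sub_self] at hy'
    -- Stability concerns every solution, so uniqueness is needed. It goes by induction over
    -- sampling intervals: on each one the control depends only on the sample at its left end.
    have hzero : ∀ n : ℕ, ∀ t, 0 ≤ t → t ≤ n * T → y t - Z t x = 0 := by
      intro n
      induction n with
      | zero =>
        intro t ht ht'
        have : t = 0 := le_antisymm (by simpa using ht') ht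
        rw [this]
        exact hy'.apply_zero hS
      | succ n ih =>
        intro t ht ht'
        have h1 := (hy'.2 t ht).2
        rw [map_zero, zero_add] at h1
        refine h1.trans ?_
        rw [intervalIntegral.integral_congr_ae (g := fun _ => 0), intervalIntegral.integral_zero]
        -- If `t = (n + 1) T`, the sample used at `s = t` is not covered by the induction
        -- hypothesis; a single point does not affect the integral.
        have hne : ∀ᵐ s : ℝ, s ≠ t := by simp [ae_iff]
        filter_upwards [hne] with s hs hs'
        rw [uIoc_of_le ht] at hs'
        have hst : s < (n + 1 : ℕ) * T := (lt_of_le_of_ne hs'.2 hs).trans_le ht'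
        have hfn : ⌊s / T⌋₊ ≤ n := by
          rw [← Nat.lt_succ_iff, Nat.floor_lt (div_nonneg hs'.1.le hT.le), div_lt_iff₀ hT]
          exact hst
        have h2 := ih ((⌊s / T⌋₊ : ℝ) * T) (by positivity) (by gcongr)
        simp only [Pi.sub_apply, sampling, ← map_sub, h2, map_zero]
    obtain ⟨n, hn⟩ := exists_nat_gt (t / T)
    rw [sub_eq_zero.1 (hzero n t ht ((div_lt_iff₀ hT).1 hn).le)]
    exact hZb x t ht

end ControlSystem

/-- Local boundedness on compact subsets of the open half-line says nothing near `0` and is not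
uniform at infinity. Periodicity carries the bound on `[T, 2T]` to both ends. -/
theorem IsPeriodicFeedback.exists_ae_norm_le {T : ℝ} (hT : 0 < T) {F : ℝ → Y →L[𝕜] U}
    (hF : IsPeriodicFeedback T F) : ∃ M : ℝ, 0 ≤ M ∧ ∀ᵐ t, 0 < t → ‖F t‖ ≤ M := by
  obtain ⟨M, hM⟩ := hF.locally_bounded (Icc T (2 * T)) isCompact_Icc
    fun t ht => hT.trans_le ht.1
  rw [ae_restrict_iff' measurableSet_Icc] at hM
  have hper := hF.periodic
  rw [ae_restrict_iff' measurableSet_Ioi] at hper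
  -- Periodicity holds only almost everywhere, so the exceptional null set has to be avoided along
  -- the whole countable orbit `t + ℤ T`.
  have hshift : ∀ (p : ℝ → Prop) (_ : ∀ᵐ t, p t), ∀ᵐ t, ∀ n : ℤ, p (t + n * T) := fun p hp =>
    ae_all_iff.2 fun n =>
    (measurePreserving_add_right volume ((n : ℝ) * T)).quasiMeasurePreserving.ae hp
  refine ⟨max M 0, le_max_right _ _, ?_⟩
  filter_upwards [hshift _ hM, hshift _ hper] with t h1 h2 ht
  refine le_trans ?_ (le_max_left _ _)
  have h3 : ∀ n : ℕ, ∀ t' : ℝ, (∃ m : ℤ, t' = t + m * T) → 0 < t' → F (t' + n * T) = F t' := by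
    intro n
    induction n with
    | zero => intro t' _ _; simp
    | succ n ih =>
      rintro _ ⟨m, rfl⟩ ht'
      have h4 := h2 (m + n) (by
        have : (0 : ℝ) ≤ n * T := by positivity
        push_cast
        simp only [mem_Ioi]
        nlinarith)
      rw [← ih _ ⟨m, rfl⟩ ht']
      convert h4 using 2 <;> push_cast <;> ring
  rcases lt_or_ge t T with htT | htT
  · have h4 := h3 1 t ⟨0, by simp⟩ ht
    rw [← h4]
    have := h1 1
    push_cast at this ⊢
    exact this ⟨by linarith, by linarith⟩
  · set n := ⌊t / T⌋₊
    have hn1 : (n : ℝ) * T ≤ t := (le_div_iff₀ hT).1 (Nat.floor_le (div_nonneg ht.le hT.le))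
    have hn2 : t < (n + 1) * T := (div_lt_iff₀ hT).1 (Nat.lt_floor_add_one (t / T))
    have hn3 : 1 ≤ n := Nat.le_floor (by rw [Nat.cast_one, le_div_iff₀ hT]; linarith)
    have h5 := h1 (1 - n)
    push_cast at h5
    have h6 := h3 (n - 1) (t + (1 - n) * T) ⟨1 - n, by push_cast; ring⟩ (by nlinarith)
    rw [Nat.cast_sub hn3, Nat.cast_one] at h6
    rw [show t = t + (1 - n) * T + (n - 1) * T by ring, h6]
    exact h5 ⟨by nlinarith, by nlinarith⟩

end Feedback

/-! ### Minimal-norm selections of linear relations. -/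

section MinimalSelection

variable {𝕜 X Y : Type*} [RCLike 𝕜] [NormedAddCommGroup X] [InnerProductSpace 𝕜 X]
  [CompleteSpace X] [NormedAddCommGroup Y] [InnerProductSpace 𝕜 Y]

/-- A linear relation with bounded selections has a bounded linear selection, up to closure, of
elements of minimal norm. -/
theorem exists_minimal_selection (G : Submodule 𝕜 (X × Y)) {M : ℝ}
    (hG : ∀ y, ∃ x, (x, y) ∈ G ∧ ‖x‖ ≤ M * ‖y‖) :
    ∃ L : Y →L[𝕜] X, (∀ x y, (x, y) ∈ G → ‖L y‖ ≤ ‖x‖) ∧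
      ∀ y, ∀ ε > 0, ∃ x, (x, y) ∈ G ∧ ‖x‖ ^ 2 ≤ ‖L y‖ ^ 2 + ε := by
  -- Two choices over the same `y` differ by an element of the fibre `G₀` over `0`. Projecting off
  -- its closure `N` therefore removes the choice and makes `q ∘ f` linear although `f` is not. The
  -- closure is the reason why minimality is attained only up to `ε`.
  set G₀ : Submodule 𝕜 X := G.comap (LinearMap.inl 𝕜 X Y)
  set N := G₀.topologicalClosure
  have hN : ∀ x, (x, (0 : Y)) ∈ G → x ∈ N := fun x hx => G₀.le_topologicalClosure hx
  let q : X →L[𝕜] X := ContinuousLinearMap.id 𝕜 X - N.starProjection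
  have hq : ∀ x, q x = x - N.starProjection x := fun x => rfl
  have hq0 : ∀ x ∈ N, q x = 0 := fun x hx => by
    rw [hq, Submodule.starProjection_eq_self_iff.2 hx, sub_self]
  have horth : ∀ x, q x ∈ Nᗮ := fun x => N.sub_starProjection_mem_orthogonal x
  have hpyth : ∀ x, ∀ n ∈ N, ‖q x + n‖ ^ 2 = ‖q x‖ ^ 2 + ‖n‖ ^ 2 := fun x n hn => by
    simpa only [sq] using norm_add_sq_eq_norm_sq_add_norm_sq_of_inner_eq_zero _ _
      (Submodule.inner_left_of_mem_orthogonal hn (horth x))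
  have hqle : ∀ x, ‖q x‖ ≤ ‖x‖ := fun x => by
    have h := hpyth x _ (N.starProjection_apply_mem x)
    rw [hq, sub_add_cancel] at h
    exact le_of_sq_le_sq (by rw [hq, h]; nlinarith [sq_nonneg ‖N.starProjection x‖]) (norm_nonneg _)
  choose f hf hfM using hG
  have hqf : ∀ x y, (x, y) ∈ G → q (f y) = q x := fun x y hxy => by
    have h := hq0 _ (hN (f y - x) (by simpa using G.sub_mem (hf y) hxy))
    rwa [map_sub, sub_eq_zero] at h
  let L : Y →L[𝕜] X := LinearMap.mkContinuous
    { toFun := fun y => q (f y)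
      map_add' := fun y z => by
        rw [hqf _ _ (G.add_mem (hf y) (hf z)), map_add]
      map_smul' := fun c y => by
        rw [hqf _ _ (G.smul_mem c (hf y)), map_smul, RingHom.id_apply] }
    M (fun y => (hqle _).trans (hfM y))
  have hL : ∀ y, L y = q (f y) := fun y => rfl
  refine ⟨L, fun x y hxy => ?_, fun y ε hε => ?_⟩
  · rw [hL, hqf x y hxy]
    exact hqle x
  · have hmem : N.starProjection (f y) ∈ closure (G₀ : Set X) := N.starProjection_apply_mem (f y)
    -- By Pythagoras an error of `√ε` inside `N` costs at most `ε` in the squared norm.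
    obtain ⟨g, hg, hgd⟩ := Metric.mem_closure_iff.1 hmem (√ε) (Real.sqrt_pos.2 hε)
    refine ⟨f y - g, by simpa using G.sub_mem (hf y) hg, ?_⟩
    have h1 : f y - g = q (f y) + (N.starProjection (f y) - g) := by rw [hq]; abel
    rw [h1, hpyth _ _ (N.sub_mem (N.starProjection_apply_mem _) (G₀.le_topologicalClosure hg)), hL]
    rw [dist_eq_norm] at hgd
    have := Real.sq_sqrt hε.le
    gcongr
    rw [← this]
    exact pow_le_pow_left₀ (norm_nonneg _) hgd.le 2

end MinimalSelection

/-! ### The quadratic cost and its value function. -/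

theorem MeasureTheory.MemLp.norm_toLp_sq {α E : Type*} [MeasurableSpace α] {μ : Measure α}
    [NormedAddCommGroup E] {f : α → E} (hf : MemLp f 2 μ) :
    ‖hf.toLp f‖ ^ 2 = ∫ a, ‖f a‖ ^ 2 ∂μ := by
  have h0 : 0 ≤ ∫ a, ‖f a‖ ^ 2 ∂μ := integral_nonneg fun a => by positivity
  rw [Lp.norm_toLp, hf.eLpNorm_eq_integral_rpow_norm (by norm_num) (by norm_num),
    ENNReal.toReal_ofReal (by positivity)]
  simp only [ENNReal.toReal_ofNat, Real.rpow_two]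
  rw [← Real.rpow_natCast, ← Real.rpow_mul h0]
  norm_num

section Value

variable {𝕜 Y U : Type*} [RCLike 𝕜] [NormedAddCommGroup Y] [InnerProductSpace 𝕜 Y]
  [NormedSpace ℝ Y] [CompleteSpace Y] [NormedAddCommGroup U] [InnerProductSpace 𝕜 U]

/-- `(u, y)` is a square integrable control together with its square integrable state. -/
structure IsAdmissible (S : ℝ → Y →L[𝕜] Y) (B : U →L[𝕜] Y) (u : ℝ → U) (y₀ : Y) (y : ℝ → Y) :
    Prop where
  isMild : IsMild S B u y₀ y
  memLp_control : MemLp u 2 (volume.restrict (Ioi 0))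
  memLp_state : MemLp y 2 (volume.restrict (Ioi 0))

/-- The quadratic cost of a control and a state over a set of times. -/
noncomputable def quadraticCost (u : ℝ → U) (y : ℝ → Y) (s : Set ℝ) : ℝ :=
  (∫ t in s, ‖u t‖ ^ 2) + ∫ t in s, ‖y t‖ ^ 2

/-- The graph of the linear relation between initial states and admissible pairs. -/
def admissibleRelation {S : ℝ → Y →L[𝕜] Y} (hS : IsC0Semigroup S) (B : U →L[𝕜] Y) :
    Submodule 𝕜 (WithLp 2 (Lp U 2 (volume.restrict (Ioi (0 : ℝ))) ×
      Lp Y 2 (volume.restrict (Ioi (0 : ℝ)))) × Y) where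
  carrier := {p | ∃ u x y, ∃ h : IsAdmissible S B u x y,
    p = (WithLp.toLp 2 (h.memLp_control.toLp u, h.memLp_state.toLp y), x)}
  zero_mem' := ⟨0, 0, 0, ⟨IsMild.zero, MemLp.zero', MemLp.zero'⟩, rfl⟩
  add_mem' := by
    rintro _ _ ⟨u, x, y, h, rfl⟩ ⟨u', x', y', h', rfl⟩
    exact ⟨u + u', x + x', y + y', ⟨h.isMild.add hS h'.isMild,
      h.memLp_control.add h'.memLp_control, h.memLp_state.add h'.memLp_state⟩, rfl⟩
  smul_mem' := by
    rintro c _ ⟨u, x, y, h, rfl⟩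
    exact ⟨c • u, c • x, c • y, ⟨h.isMild.smul hS c, h.memLp_control.const_smul c,
      h.memLp_state.const_smul c⟩, rfl⟩

/-- The square root of the value function of the quadratic cost, as a bounded operator. -/
theorem IsC0Semigroup.exists_valueOperator [CompleteSpace U] {S : ℝ → Y →L[𝕜] Y}
    (hS : IsC0Semigroup S) (B : U →L[𝕜] Y) {M : ℝ}
    (hM : ∀ x, ∃ u y, IsAdmissible S B u x y ∧ quadraticCost u y (Ioi 0) ≤ M ^ 2 * ‖x‖ ^ 2) :
    ∃ L : Y →L[𝕜] WithLp 2 (Lp U 2 (volume.restrict (Ioi (0 : ℝ))) ×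
        Lp Y 2 (volume.restrict (Ioi (0 : ℝ)))),
      (∀ u x y, IsAdmissible S B u x y → ‖L x‖ ^ 2 ≤ quadraticCost u y (Ioi 0)) ∧
      ∀ x, ∀ ε > 0, ∃ u y, IsAdmissible S B u x y ∧
        quadraticCost u y (Ioi 0) ≤ ‖L x‖ ^ 2 + ε := by
  have hnorm : ∀ {u x y} (h : IsAdmissible S B u x y),
      ‖WithLp.toLp 2 (h.memLp_control.toLp u, h.memLp_state.toLp y)‖ ^ 2 =
        quadraticCost u y (Ioi 0) := fun h => by
    rw [WithLp.prod_norm_sq_eq_of_L2]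
    exact congrArg₂ _ h.memLp_control.norm_toLp_sq h.memLp_state.norm_toLp_sq
  obtain ⟨L, hL1, hL2⟩ := exists_minimal_selection (admissibleRelation hS B) (M := |M|) fun x => by
    obtain ⟨u, y, h, hc⟩ := hM x
    refine ⟨_, ⟨u, x, y, h, rfl⟩, le_of_sq_le_sq ?_ (by positivity)⟩
    rw [hnorm h, mul_pow, sq_abs]
    exact hc
  refine ⟨L, fun u x y h => ?_, fun x ε hε => ?_⟩
  · rw [← hnorm h]
    exact pow_le_pow_left₀ (norm_nonneg _) (hL1 _ _ ⟨u, x, y, h, rfl⟩) 2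
  · obtain ⟨_, ⟨u, _, y, h, heq⟩, hc⟩ := hL2 x ε hε
    obtain ⟨rfl, rfl⟩ := Prod.mk.inj heq
    exact ⟨u, y, h, (hnorm h).symm.trans_le hc⟩

end Value

/-! ### Strong continuity of the adjoint semigroup. -/

section Adjoint

variable {𝕜 Y : Type*} [RCLike 𝕜] [NormedAddCommGroup Y] [InnerProductSpace 𝕜 Y]
  [CompleteSpace Y] {S : ℝ → Y →L[𝕜] Y}

open IsC0Semigroup (extend extend_of_nonneg)
open ContinuousLinearMap (adjoint)

/-- The integral of a strongly continuous semigroup over `[0, h]`. -/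
theorem IsC0Semigroup.exists_integral [NormedSpace ℝ Y] (hS : IsC0Semigroup S) (h : ℝ) :
    ∃ Q : Y →L[𝕜] Y, ∀ x, Q x = ∫ s in (0 : ℝ)..h, extend S s x := by
  obtain ⟨M, hM, hb⟩ := hS.exists_norm_extend_le (max 0 h)
  have hc : ∀ x, Continuous fun s => extend S s x := fun x =>
    hS.continuous_extend_comp continuous_id continuous_const
  refine ⟨LinearMap.mkContinuous
    { toFun := fun x => ∫ s in (0 : ℝ)..h, extend S s x
      map_add' := fun x y => by
        simp only [_root_.map_add]
        exact intervalIntegral.integral_add ((hc x).intervalIntegrable _ _)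
          ((hc y).intervalIntegrable _ _)
      map_smul' := fun c x => by
        simp only [map_smul, RingHom.id_apply]
        exact (c • ContinuousLinearMap.id 𝕜 Y).intervalIntegral_comp_comm
          ((hc x).intervalIntegrable _ _) }
    (M * |h|) fun x => ?_, fun x => rfl⟩
  refine (intervalIntegral.norm_integral_le_of_norm_le_const (C := M * ‖x‖) fun s hs =>
    (ContinuousLinearMap.le_opNorm _ _).trans (mul_le_mul_of_nonneg_right
      (hb s hs.2) (norm_nonneg _))).trans_eq ?_
  rw [sub_zero]
  ring

/-- Adjoints have the norms of the original operators, so they are uniformly bounded near `0` and an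
`ε`-argument applies. -/
theorem IsC0Semigroup.isClosed_setOf_tendsto_adjoint (hS : IsC0Semigroup S) :
    IsClosed {q : Y | Tendsto (fun t => adjoint (S t) q) (𝓝[≥] 0) (𝓝 q)} := by
  obtain ⟨M, hM, hb⟩ := hS.exists_norm_extend_le 1
  have hb' : ∀ᶠ t in 𝓝[≥] (0 : ℝ), ∀ x, ‖adjoint (S t) x‖ ≤ M * ‖x‖ := by
    filter_upwards [self_mem_nhdsWithin, nhdsWithin_le_nhds (Iio_mem_nhds one_pos)] with t ht ht1 x
    refine (ContinuousLinearMap.le_opNorm _ _).trans (mul_le_mul_of_nonneg_right ?_ (norm_nonneg _))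
    rw [LinearIsometryEquiv.norm_map, ← extend_of_nonneg (S := S) ht]
    exact hb t (le_of_lt ht1)
  refine isClosed_of_closure_subset fun q hq => ?_
  rw [mem_ofPred_eq, Metric.tendsto_nhds]
  intro ε hε
  obtain ⟨x, hx, hqx⟩ := Metric.mem_closure_iff.1 hq (ε / (2 * (M + 1))) (by positivity)
  filter_upwards [hb', (Metric.tendsto_nhds.1 hx) (ε / 2) (by positivity)] with t h1 h2
  rw [dist_eq_norm] at *
  have h3 : adjoint (S t) q - q = adjoint (S t) (q - x) + (adjoint (S t) x - x) - (q - x) := by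
    rw [map_sub]; abel
  rw [lt_div_iff₀ (by positivity)] at hqx
  calc _ ≤ M * ‖q - x‖ + ‖adjoint (S t) x - x‖ + ‖q - x‖ := by
        rw [h3]
        exact (_root_.norm_sub_le _ _).trans (add_le_add_left ((norm_add_le _ _).trans
          (add_le_add_left (h1 _) _)) _)
    _ < ε := by linarith

/-- The adjoint semigroup on a Hilbert space is strongly continuous. -/
theorem IsC0Semigroup.tendsto_adjoint (hS : IsC0Semigroup S) (q : Y) :
    Tendsto (fun t => adjoint (S t) q) (𝓝[≥] 0) (𝓝 q) := by
  let : NormedSpace ℝ Y := NormedSpace.restrictScalars ℝ 𝕜 Y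
  have hc : ∀ x, Continuous fun s => extend S s x := fun x =>
    hS.continuous_extend_comp continuous_id continuous_const
  -- `D` is the closed subspace on which the claim holds; it remains to show that `D` is dense.
  let D : Submodule 𝕜 Y :=
    { carrier := {q : Y | Tendsto (fun t => adjoint (S t) q) (𝓝[≥] 0) (𝓝 q)}
      zero_mem' := by simp
      add_mem' := fun ha hb => by
        simp only [mem_ofPred_eq, _root_.map_add] at *
        exact ha.add hb
      smul_mem' := fun c a ha => by
        simp only [mem_ofPred_eq, map_smul] at *
        exact ha.const_smul c }
  have hDclosed : IsClosed (D : Set Y) := hS.isClosed_setOf_tendsto_adjoint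
  choose Q hQ using fun h => hS.exists_integral h
  -- `Q h ∘ S t - Q h` integrates the orbit over `[h, h + t]` minus `[0, t]`, so its norm is at most
  -- `2 M t`; the adjoint inherits this bound.
  have hQD : ∀ h x, 0 < h → adjoint (Q h) x ∈ D := by
    intro h x hh
    obtain ⟨M, hM, hb⟩ := hS.exists_norm_extend_le (h + 1)
    change Tendsto _ _ _
    rw [tendsto_iff_norm_sub_tendsto_zero]
    have hlim : Tendsto (fun t : ℝ => 2 * M * t * ‖x‖) (𝓝[≥] 0) (𝓝 0) := by
      have : Tendsto (fun t : ℝ => 2 * M * t * ‖x‖) (𝓝 0) (𝓝 (2 * M * 0 * ‖x‖)) :=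
        (Continuous.tendsto (by fun_prop) 0)
      simpa using this.mono_left nhdsWithin_le_nhds
    refine squeeze_zero' (Eventually.of_forall fun _ => norm_nonneg _) ?_ hlim
    filter_upwards [self_mem_nhdsWithin, nhdsWithin_le_nhds (Iio_mem_nhds one_pos)] with t ht ht1
    have h1 : adjoint (S t) (adjoint (Q h) x) - adjoint (Q h) x =
        adjoint ((Q h).comp (S t) - Q h) x := by
      rw [map_sub, ContinuousLinearMap.adjoint_comp]
      rfl
    rw [h1]
    refine (ContinuousLinearMap.le_opNorm _ _).trans (mul_le_mul_of_nonneg_right ?_ (norm_nonneg _))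
    rw [LinearIsometryEquiv.norm_map]
    refine ContinuousLinearMap.opNorm_le_bound _ (by have : (0:ℝ) ≤ t := ht; positivity)
      fun z => ?_
    have ht0 : (0 : ℝ) ≤ t := ht
    have ht1' : t < 1 := ht1
    have h2 : Q h (S t z) = ∫ s in t..h + t, extend S s z := by
      rw [hQ]
      have h3 := intervalIntegral.integral_comp_add_right (fun s => extend S s z) (a := 0) (b := h) t
      rw [zero_add] at h3
      rw [← h3]
      refine intervalIntegral.integral_congr fun s hs => ?_
      rw [uIcc_of_le hh.le] at hs
      rw [hS.extend_add hs.1 ht0, extend_of_nonneg ht0]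
    have hi : ∀ a b, IntervalIntegrable (fun s => extend S s z) volume a b :=
      fun a b => (hc z).intervalIntegrable a b
    have h4 : (∫ s in t..h + t, extend S s z) - ∫ s in (0 : ℝ)..h, extend S s z =
        (∫ s in h..h + t, extend S s z) - ∫ s in (0 : ℝ)..t, extend S s z := by
      rw [← intervalIntegral.integral_add_adjacent_intervals (hi t h) (hi h (h + t)),
        ← intervalIntegral.integral_add_adjacent_intervals (hi 0 t) (hi t h)]
      abel
    have hbd : ∀ a, 0 ≤ a → a + t ≤ h + 1 → ‖∫ s in a..a + t, extend S s z‖ ≤ M * ‖z‖ * t := by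
      intro a ha hat
      refine (intervalIntegral.norm_integral_le_of_norm_le_const (C := M * ‖z‖) fun s hs =>
        (ContinuousLinearMap.le_opNorm _ _).trans (mul_le_mul_of_nonneg_right
          (hb s ?_) (norm_nonneg _))).trans_eq ?_
      · rw [uIoc_of_le (by linarith)] at hs
        exact hs.2.trans hat
      · rw [add_sub_cancel_left, abs_of_nonneg ht0]
    have hbd0 := hbd 0 le_rfl (by linarith)
    rw [zero_add] at hbd0
    rw [sub_apply, ContinuousLinearMap.comp_apply, h2, hQ, h4]
    refine (_root_.norm_sub_le _ _).trans ((add_le_add (hbd h hh.le (by linarith)) hbd0).trans_eq ?_)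
    ring
  -- If `z` is orthogonal to `D`, then `∫₀ʰ S s z = 0` for all `h > 0`; the right derivative at `0`
  -- gives `z = 0`.
  have hD : Dᗮ = ⊥ := by
    rw [Submodule.eq_bot_iff]
    intro z hz
    have hQz : ∀ h, 0 < h → Q h z = 0 := by
      intro h hh
      rw [← inner_self_eq_zero (𝕜 := 𝕜), ← ContinuousLinearMap.adjoint_inner_left]
      exact Submodule.inner_right_of_mem_orthogonal (hQD h (Q h z) hh) hz
    have hder : HasDerivWithinAt (fun h => ∫ s in (0 : ℝ)..h, extend S s z) (extend S 0 z)
        (Ici 0) 0 := ((hc z).integral_hasStrictDerivAt 0 0).hasDerivAt.hasDerivWithinAt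
    have hzero : HasDerivWithinAt (fun h => ∫ s in (0 : ℝ)..h, extend S s z) 0 (Ici 0) 0 := by
      refine (hasDerivWithinAt_const (0 : ℝ) (Ici 0) (0 : Y)).congr (fun h hh => ?_) (by simp)
      rcases eq_or_lt_of_le (mem_Ici.1 hh) with rfl | hh
      · simp
      · rw [← hQ, hQz h hh]
    have := (uniqueDiffWithinAt_Ici (0 : ℝ)).eq_deriv _ hder hzero
    rwa [hS.extend_zero] at this
  have hDtop : D = ⊤ := by
    have h1 := (Submodule.topologicalClosure_eq_top_iff (K := D)).2 hD
    rwa [hDclosed.submodule_topologicalClosure_eq] at h1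
  have : q ∈ D := hDtop ▸ Submodule.mem_top
  exact this

end Adjoint

/-! ### Dynamic programming: decrease of the value function along the closed loop. -/

section Decrease

variable {𝕜 Y U : Type*} [RCLike 𝕜] [NormedAddCommGroup Y] [InnerProductSpace 𝕜 Y]
  [NormedSpace ℝ Y] [CompleteSpace Y] [NormedAddCommGroup U] [InnerProductSpace 𝕜 U]
  {S : ℝ → Y →L[𝕜] Y} {B : U →L[𝕜] Y}

open IsC0Semigroup (extend extend_of_nonneg)
open ContinuousLinearMap (adjoint)

theorem measurePreserving_add_right_restrict_Ioi (h : ℝ) :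
    MeasurePreserving (fun t : ℝ => t + h) (volume.restrict (Ioi 0)) (volume.restrict (Ioi h)) := by
  have := (measurePreserving_add_right volume h).restrict_preimage (measurableSet_Ioi (a := h))
  simpa using this

theorem IsAdmissible.shift (hS : IsC0Semigroup S) {u : ℝ → U} {x : Y} {y : ℝ → Y}
    (hy : IsAdmissible S B u x y) {h : ℝ} (hh : 0 ≤ h) :
    IsAdmissible S B (fun t => u (t + h)) (y h) (fun t => y (t + h)) :=
  ⟨hy.isMild.shift hS hh,
    (hy.memLp_control.mono_measure (Measure.restrict_mono_set _
      (Ioi_subset_Ioi hh))).comp_measurePreserving (measurePreserving_add_right_restrict_Ioi h),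
    (hy.memLp_state.mono_measure (Measure.restrict_mono_set _
      (Ioi_subset_Ioi hh))).comp_measurePreserving (measurePreserving_add_right_restrict_Ioi h)⟩

theorem MeasureTheory.MemLp.integral_Ioc_add_shift {E : Type*} [NormedAddCommGroup E] {f : ℝ → E}
    (hf : MemLp f 2 (volume.restrict (Ioi 0))) {h : ℝ} (hh : 0 ≤ h) :
    (∫ t in Ioc 0 h, ‖f t‖ ^ 2) + ∫ t in Ioi 0, ‖f (t + h)‖ ^ 2 = ∫ t in Ioi 0, ‖f t‖ ^ 2 := by
  have hi : IntegrableOn (fun t => ‖f t‖ ^ 2) (Ioi 0) := hf.integrable_norm_pow two_ne_zero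
  have h1 : ∫ t in Ioi 0, ‖f (t + h)‖ ^ 2 = ∫ t in Ioi h, ‖f t‖ ^ 2 :=
    (measurePreserving_add_right_restrict_Ioi h).integral_comp
      (measurableEmbedding_addRight h) (fun t => ‖f t‖ ^ 2)
  rw [h1, ← setIntegral_union (Ioc_disjoint_Ioi le_rfl) measurableSet_Ioi
    (hi.mono_set Ioc_subset_Ioi_self) (hi.mono_set (Ioi_subset_Ioi hh)), Ioc_union_Ioi_eq_Ioi hh]

theorem IsAdmissible.quadraticCost_add_shift {u : ℝ → U} {x : Y} {y : ℝ → Y}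
    (hy : IsAdmissible S B u x y) {h : ℝ} (hh : 0 ≤ h) :
    quadraticCost u y (Ioc 0 h) +
      quadraticCost (fun t => u (t + h)) (fun t => y (t + h)) (Ioi 0) =
        quadraticCost u y (Ioi 0) := by
  simp only [quadraticCost]
  rw [← hy.memLp_control.integral_Ioc_add_shift hh, ← hy.memLp_state.integral_Ioc_add_shift hh]
  ring

/-- For `x` outside the domain of the generator neither `z h` nor `S h x` need be differentiable at
`0`, but their difference is the integral of a continuous function and is. -/
theorem IsMild.tendsto_closedLoop_sub_div (hS : IsC0Semigroup S) {F : Y →L[𝕜] U} {x : Y}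
    {z : ℝ → Y} (hzc : Continuous z) (hz : IsMild S B (fun t => F (z t)) x z) :
    Tendsto (fun h : ℝ => ((h⁻¹ : ℝ) : 𝕜) • (z h - S h x)) (𝓝[>] 0) (𝓝 (B (F x))) := by
  have hz0 : z 0 = x := hz.apply_zero hS
  have hc : Continuous fun p : ℝ × ℝ => extend S (p.1 - p.2) (B (F (z p.2))) :=
    hS.continuous_extend_comp (by fun_prop) (by fun_prop)
  rw [Metric.tendsto_nhds]
  intro ε hε
  have h0 : Tendsto (fun p : ℝ × ℝ => extend S (p.1 - p.2) (B (F (z p.2)))) (𝓝 (0, 0))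
      (𝓝 (B (F x))) := by
    have := hc.tendsto (0, 0)
    simpa [hz0, hS.extend_zero] using this
  obtain ⟨δ, hδ, hball⟩ := Metric.mem_nhds_iff.1
    ((Metric.tendsto_nhds.1 h0) (ε / 2) (by positivity))
  filter_upwards [self_mem_nhdsWithin, nhdsWithin_le_nhds (Iio_mem_nhds hδ)] with h hh hhδ
  have hh0 : (0 : ℝ) < h := hh
  have hhδ' : h < δ := hhδ
  have hi : IntervalIntegrable (fun s => extend S (h - s) (B (F (z s)))) volume 0 h :=
    Continuous.intervalIntegrable
      (hS.continuous_extend_comp (by fun_prop) (by fun_prop)) _ _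
  have h1 : z h - S h x - (∫ _ in (0 : ℝ)..h, B (F x)) =
      ∫ s in (0 : ℝ)..h, (extend S (h - s) (B (F (z s))) - B (F x)) := by
    rw [intervalIntegral.integral_sub hi (by simp), (hz.2 h hh0.le).2, extend_of_nonneg hh0.le,
      add_sub_cancel_left]
  have h2 : ‖z h - S h x - ∫ _ in (0 : ℝ)..h, B (F x)‖ ≤ ε / 2 * h := by
    rw [h1]
    refine (intervalIntegral.norm_integral_le_of_norm_le_const (C := ε / 2)
      fun s hs => ?_).trans_eq (by rw [sub_zero, abs_of_pos hh0])
    rw [uIoc_of_le hh0.le] at hs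
    have hmem : (h, s) ∈ Metric.ball ((0 : ℝ), (0 : ℝ)) δ := by
      rw [Metric.mem_ball, Prod.dist_eq, Real.dist_0_eq_abs, Real.dist_0_eq_abs, max_lt_iff,
        abs_of_pos hh0, abs_of_pos hs.1]
      exact ⟨hhδ', hs.2.trans_lt hhδ'⟩
    have := hball hmem
    rw [mem_ofPred_eq, dist_eq_norm] at this
    exact this.le
  have h3 : (∫ _ in (0 : ℝ)..h, B (F x)) = (h : 𝕜) • B (F x) := by
    rw [intervalIntegral.integral_const, sub_zero]
    exact (RCLike.real_smul_eq_coe_smul (K := 𝕜) h (B (F x)))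
  rw [h3] at h2
  have h4 : ((h⁻¹ : ℝ) : 𝕜) • (z h - S h x) - B (F x) =
      ((h⁻¹ : ℝ) : 𝕜) • (z h - S h x - (h : 𝕜) • B (F x)) := by
    rw [smul_sub _ (z h - S h x), smul_smul, ← RCLike.ofReal_mul, inv_mul_cancel₀ hh0.ne',
      RCLike.ofReal_one, one_smul]
  rw [dist_eq_norm, h4, norm_smul, RCLike.norm_ofReal, abs_of_pos (inv_pos.2 hh0)]
  calc h⁻¹ * _ ≤ h⁻¹ * (ε / 2 * h) := by gcongr
    _ = ε / 2 := by field_simp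
    _ < ε := by linarith

end Decrease

theorem exists_pos_abs_sq_sub_sq_le {a ε : ℝ} (ha : 0 ≤ a) (hε : 0 < ε) :
    ∃ δ > 0, ∀ b, 0 ≤ b → |b - a| ≤ δ → |b ^ 2 - a ^ 2| ≤ ε := by
  refine ⟨min 1 (ε / (2 * a + 1)), lt_min one_pos (by positivity), fun b hb hab => ?_⟩
  have h1 := hab.trans (min_le_left _ _)
  have h2 := hab.trans (min_le_right _ _)
  rw [le_div_iff₀ (by positivity)] at h2
  rw [show b ^ 2 - a ^ 2 = (b - a) * (b + a) by ring, abs_mul, abs_of_nonneg (by positivity : 0 ≤ b + a)]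
  refine le_trans (mul_le_mul_of_nonneg_left ?_ (abs_nonneg _)) h2
  linarith [le_abs_self (b - a)]

section Decrease

variable {𝕜 Y U X : Type*} [RCLike 𝕜] [NormedAddCommGroup Y] [InnerProductSpace 𝕜 Y]
  [NormedSpace ℝ Y] [CompleteSpace Y] [NormedAddCommGroup U] [InnerProductSpace 𝕜 U]
  [CompleteSpace U]
  [NormedAddCommGroup X] [InnerProductSpace 𝕜 X] [CompleteSpace X]
  {S : ℝ → Y →L[𝕜] Y} {B : U →L[𝕜] Y} {L : Y →L[𝕜] X}

open IsC0Semigroup (extend extend_of_nonneg)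
open ContinuousLinearMap (adjoint)

/-- Strong continuity of the adjoint semigroup makes the bound uniform in `r ≤ h`; replacing `x` by
`S h x` then costs only operator norms times `‖S h x - x‖`. -/
theorem IsC0Semigroup.eventually_norm_adjoint_sq_le (hS : IsC0Semigroup S) (L : Y →L[𝕜] X)
    (B : U →L[𝕜] Y) (x : Y) {ε : ℝ} (hε : 0 < ε) :
    ∀ᶠ h in 𝓝[>] (0 : ℝ), ∀ r, 0 ≤ r → r ≤ h →
      ‖adjoint B (adjoint (S r) (adjoint L (L (S h x))))‖ ^ 2 ≤
        ‖adjoint B (adjoint L (L x))‖ ^ 2 + ε := by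
  obtain ⟨δ, hδ, hδε⟩ := exists_pos_abs_sq_sub_sq_le
    (norm_nonneg (adjoint B (adjoint L (L x)))) hε
  obtain ⟨M, hM, hb⟩ := hS.exists_norm_extend_le 1
  have h1 : ∀ᶠ r in 𝓝[≥] (0 : ℝ), ‖adjoint B (adjoint (S r) (adjoint L (L x))) -
      adjoint B (adjoint L (L x))‖ < δ / 2 := by
    have := ((adjoint B).continuous.tendsto _).comp (hS.tendsto_adjoint (adjoint L (L x)))
    have := (Metric.tendsto_nhds.1 this) (δ / 2) (by positivity)
    simpa only [dist_eq_norm, Function.comp_apply] using this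
  obtain ⟨η, hη, hη'⟩ := (mem_nhdsGE_iff_exists_Ico_subset).1 h1
  have h2 : ∀ᶠ h in 𝓝[>] (0 : ℝ),
      ‖adjoint B‖ * (M * (‖adjoint L‖ * (‖L‖ * ‖S h x - x‖))) < δ / 2 := by
    have h3 : Tendsto (fun h => ‖S h x - x‖) (𝓝[>] 0) (𝓝 0) :=
      tendsto_iff_norm_sub_tendsto_zero.1 (hS.tendsto_zero x)
    have h4 := (((h3.const_mul ‖L‖).const_mul ‖adjoint L‖).const_mul M).const_mul ‖adjoint B‖
    simp only [mul_zero] at h4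
    exact (tendsto_order.1 h4).2 _ (by positivity)
  filter_upwards [h2, self_mem_nhdsWithin, nhdsWithin_le_nhds (Iio_mem_nhds one_pos),
    nhdsWithin_le_nhds (Iio_mem_nhds hη)] with h h3 hh hh1 hhη r hr hrh
  have hh1' : h < 1 := hh1
  have h5 : ‖adjoint B (adjoint (S r) (adjoint L (L x))) - adjoint B (adjoint L (L x))‖ < δ / 2 :=
    hη' ⟨hr, hrh.trans_lt hhη⟩
  have h6 : ‖adjoint B (adjoint (S r) (adjoint L (L (S h x)))) -
      adjoint B (adjoint (S r) (adjoint L (L x)))‖ < δ / 2 := by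
    refine lt_of_le_of_lt ?_ h3
    simp only [← map_sub]
    refine (ContinuousLinearMap.le_opNorm _ _).trans ?_
    gcongr
    refine (ContinuousLinearMap.le_opNorm _ _).trans ?_
    gcongr
    · rw [LinearIsometryEquiv.norm_map, ← extend_of_nonneg (S := S) hr]
      exact hb r (hrh.trans hh1'.le)
    refine (ContinuousLinearMap.le_opNorm _ _).trans ?_
    gcongr
    exact ContinuousLinearMap.le_opNorm _ _
  have h7 := hδε _ (norm_nonneg (adjoint B (adjoint (S r) (adjoint L (L (S h x)))))) (by
    refine (abs_norm_sub_norm_le _ _).trans ?_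
    refine (norm_sub_le_norm_sub_add_norm_sub _ (adjoint B (adjoint (S r) (adjoint L (L x))))
      _).trans ?_
    linarith)
  linarith [(abs_le.1 h7).2]

/-- Duality moves `S (h - s) B` onto `q`, and `-2 Re ⟨p, u⟩ ≤ ‖p‖² + ‖u‖²` does the rest. The
control energy gets coefficient exactly one, so that it later cancels against the running cost. -/
theorem IsMild.neg_re_inner_le (hS : IsC0Semigroup S) {u : ℝ → U} {x : Y} {y : ℝ → Y}
    (hy : IsMild S B u x y) (hu : MemLp u 2 (volume.restrict (Ioi 0))) {h c : ℝ} (hh : 0 ≤ h)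
    {q : Y} (hc : ∀ r, 0 ≤ r → r ≤ h → ‖adjoint B (adjoint (S r) q)‖ ^ 2 ≤ c) :
    -(2 * RCLike.re (inner 𝕜 q (y h - S h x))) ≤ (∫ s in Ioc 0 h, ‖u s‖ ^ 2) + h * c := by
  have hi := hS.intervalIntegrable_extend B hh (hy.2 h hh).1 h
  have h1 : inner 𝕜 q (y h - S h x) =
      ∫ s in (0 : ℝ)..h, inner 𝕜 q (extend S (h - s) (B (u s))) := by
    rw [(hy.2 h hh).2, extend_of_nonneg hh, add_sub_cancel_left]
    exact ((innerSL 𝕜 q).intervalIntegral_comp_comm hi).symm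
  have hi2 : IntervalIntegrable (fun s => inner 𝕜 q (extend S (h - s) (B (u s)))) volume 0 h := by
    rw [intervalIntegrable_iff_integrableOn_Ioc_of_le hh] at hi ⊢
    exact (innerSL 𝕜 q).integrable_comp hi
  have hi3 : IntervalIntegrable (fun s => RCLike.re (inner 𝕜 q (extend S (h - s) (B (u s)))))
      volume 0 h := by
    rw [intervalIntegrable_iff_integrableOn_Ioc_of_le hh] at hi2 ⊢
    exact hi2.re
  have h2 : RCLike.re (inner 𝕜 q (y h - S h x)) =
      ∫ s in (0 : ℝ)..h, RCLike.re (inner 𝕜 q (extend S (h - s) (B (u s)))) := by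
    rw [h1]
    exact ((RCLike.reCLM (K := 𝕜)).intervalIntegral_comp_comm hi2).symm
  have hu2 : IntervalIntegrable (fun s => ‖u s‖ ^ 2) volume 0 h := by
    rw [intervalIntegrable_iff_integrableOn_Ioc_of_le hh]
    exact (hu.integrable_norm_pow two_ne_zero).mono_measure
      (Measure.restrict_mono_set _ Ioc_subset_Ioi_self)
  rw [h2, ← neg_mul, ← intervalIntegral.integral_const_mul,
    ← intervalIntegral.integral_of_le hh]
  have h3 : ∫ s in (0 : ℝ)..h, (‖u s‖ ^ 2 + c) = (∫ s in (0 : ℝ)..h, ‖u s‖ ^ 2) + h * c := by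
    rw [intervalIntegral.integral_add hu2 (by simp), intervalIntegral.integral_const]
    simp
  rw [← h3]
  refine intervalIntegral.integral_mono_on hh (hi3.const_mul _) (hu2.add (by simp)) fun s hs => ?_
  have hsh : 0 ≤ h - s := by linarith [hs.2]
  rw [extend_of_nonneg hsh, ← ContinuousLinearMap.adjoint_inner_left,
    ← ContinuousLinearMap.adjoint_inner_left]
  have h4 := hc (h - s) hsh (by linarith [hs.1])
  have h5 := (RCLike.abs_re_le_norm _).trans
    (norm_inner_le_norm (𝕜 := 𝕜) (adjoint B (adjoint (S (h - s)) q)) (u s))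
  nlinarith [(abs_le.1 h5).1, sq_nonneg (‖adjoint B (adjoint (S (h - s)) q)‖ - ‖u s‖)]

/-- The pointwise bound `‖u‖ ≤ √h ‖u‖² + 1 / √h` replaces Cauchy–Schwarz; both terms integrate to
order `√h`. -/
theorem integral_norm_le_sqrt_mul {u : ℝ → U} (hu : MemLp u 2 (volume.restrict (Ioi 0))) {h : ℝ}
    (hh : 0 < h) (hi : IntegrableOn u (Ioc 0 h)) :
    ∫ s in (0 : ℝ)..h, ‖u s‖ ≤ √h * ((∫ s in Ioi 0, ‖u s‖ ^ 2) + 1) := by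
  have hk : 0 < √h := Real.sqrt_pos.2 hh
  have hu1 : IntegrableOn (fun s => ‖u s‖ ^ 2) (Ioi 0) := hu.integrable_norm_pow two_ne_zero
  have hu2 : IntervalIntegrable (fun s => ‖u s‖ ^ 2) volume 0 h := by
    rw [intervalIntegrable_iff_integrableOn_Ioc_of_le hh.le]
    exact hu1.mono_set Ioc_subset_Ioi_self
  calc ∫ s in (0 : ℝ)..h, ‖u s‖ ≤ ∫ s in (0 : ℝ)..h, (√h * ‖u s‖ ^ 2 + 1 / √h) := by
        refine intervalIntegral.integral_mono_on hh.le ?_ ((hu2.const_mul _).add (by simp))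
          fun s _ => ?_
        · rw [intervalIntegrable_iff_integrableOn_Ioc_of_le hh.le]
          exact hi.norm
        · rw [← sub_nonneg]
          have : √h * ‖u s‖ ^ 2 + 1 / √h - ‖u s‖ =
              ((√h * ‖u s‖ - 1 / 2) ^ 2 + 3 / 4) / √h := by
            field_simp
            ring
          rw [this]
          positivity
    _ = √h * (∫ s in (0 : ℝ)..h, ‖u s‖ ^ 2) + h / √h := by
        rw [intervalIntegral.integral_add (hu2.const_mul _) (by simp),
          intervalIntegral.integral_const_mul, intervalIntegral.integral_const]
        simp [div_eq_mul_inv]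
    _ ≤ √h * (∫ s in Ioi 0, ‖u s‖ ^ 2) + √h := by
        rw [Real.div_sqrt, intervalIntegral.integral_of_le hh.le]
        gcongr
        · exact Eventually.of_forall fun s => by positivity
        · exact Ioc_subset_Ioi_self
    _ = _ := by ring

theorem quadraticCost_control_le (u : ℝ → U) (y : ℝ → Y) (s : Set ℝ) :
    ∫ t in s, ‖u t‖ ^ 2 ≤ quadraticCost u y s :=
  le_add_of_nonneg_right (integral_nonneg fun _ => by positivity)

/-- For a near-optimal pair the tail is admissible from `y h`, so `V (y h) ≤ V x + h ε / 3 - ∫₀ʰ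
(‖u‖² + ‖y‖²)`. Expanding `V = ‖L ·‖²` about `S h x`, dropping the square and bounding the cross
term cancels `∫ ‖u‖²`. What remains is a one-sided Riccati inequality along the free semigroup. -/
theorem eventually_value_semigroup_sub_le (hS : IsC0Semigroup S)
    (hL : ∀ u x y, IsAdmissible S B u x y → ‖L x‖ ^ 2 ≤ quadraticCost u y (Ioi 0))
    (hL' : ∀ x, ∀ ε > 0, ∃ u y, IsAdmissible S B u x y ∧
      quadraticCost u y (Ioi 0) ≤ ‖L x‖ ^ 2 + ε) (x : Y) {ε : ℝ} (hε : 0 < ε) :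
    ∀ᶠ h in 𝓝[>] (0 : ℝ), ‖L (S h x)‖ ^ 2 - ‖L x‖ ^ 2 ≤
      h * (‖adjoint B (adjoint L (L x))‖ ^ 2 - ‖x‖ ^ 2 + ε) := by
  obtain ⟨δ, hδ, hδε⟩ := exists_pos_abs_sq_sub_sq_le (norm_nonneg x) (by positivity : 0 < ε / 3)
  obtain ⟨M, hM, hb⟩ := hS.exists_norm_extend_le 1
  have h1 : ∀ᶠ r in 𝓝[≥] (0 : ℝ), ‖S r x - x‖ < δ / 2 := by
    have := (Metric.tendsto_nhds.1 (hS.tendsto_zero' x)) (δ / 2) (by positivity)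
    simpa only [dist_eq_norm] using this
  obtain ⟨η, hη, hη'⟩ := (mem_nhdsGE_iff_exists_Ico_subset).1 h1
  -- The near-optimal control depends on `h`, since its defect must be small relative to `h`.
  -- Closeness of `y` to the free orbit may therefore use only the cost bound `‖L x‖² + ε / 3`,
  -- valid as `h < 1`.
  have h2 : ∀ᶠ h in 𝓝[>] (0 : ℝ), M * ‖B‖ * (√h * (‖L x‖ ^ 2 + ε / 3 + 1)) < δ / 2 := by
    have : Tendsto (fun h => M * ‖B‖ * (√h * (‖L x‖ ^ 2 + ε / 3 + 1))) (𝓝 0)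
        (𝓝 (M * ‖B‖ * (√0 * (‖L x‖ ^ 2 + ε / 3 + 1)))) :=
      Continuous.tendsto (by fun_prop) 0
    simp only [Real.sqrt_zero, zero_mul, mul_zero] at this
    exact nhdsWithin_le_nhds ((tendsto_order.1 this).2 _ (by positivity))
  filter_upwards [h2, self_mem_nhdsWithin, nhdsWithin_le_nhds (Iio_mem_nhds one_pos),
    nhdsWithin_le_nhds (Iio_mem_nhds hη),
    hS.eventually_norm_adjoint_sq_le L B x (by positivity : 0 < ε / 3)] with h h3 hh hh1 hhη hadj
  have hh0 : 0 < h := hh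
  have hh1' : h < 1 := hh1
  obtain ⟨u, y, hy, hcost⟩ := hL' x (h * (ε / 3)) (by positivity)
  have htail := hL _ _ _ (hy.shift hS hh0.le)
  have hsplit := hy.quadraticCost_add_shift hh0.le
  have hcross := hy.isMild.neg_re_inner_le hS hy.memLp_control hh0.le (q := adjoint L (L (S h x)))
    hadj
  have hexp : ‖L (y h)‖ ^ 2 = ‖L (S h x)‖ ^ 2 +
      2 * RCLike.re (inner 𝕜 (adjoint L (L (S h x))) (y h - S h x)) + ‖L (y h - S h x)‖ ^ 2 := by
    rw [ContinuousLinearMap.adjoint_inner_left, ← norm_add_sq (𝕜 := 𝕜), ← map_add,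
      add_sub_cancel]
  have hstate : h * (‖x‖ ^ 2 - ε / 3) ≤ ∫ s in Ioc 0 h, ‖y s‖ ^ 2 := by
    have hyi : IntervalIntegrable (fun s => ‖y s‖ ^ 2) volume 0 h := by
      rw [intervalIntegrable_iff_integrableOn_Ioc_of_le hh0.le]
      exact (hy.memLp_state.integrable_norm_pow two_ne_zero).mono_measure
        (Measure.restrict_mono_set _ Ioc_subset_Ioi_self)
    have hc : ∫ _ in (0 : ℝ)..h, (‖x‖ ^ 2 - ε / 3) = h * (‖x‖ ^ 2 - ε / 3) := by
      rw [intervalIntegral.integral_const, sub_zero, smul_eq_mul]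
    rw [← intervalIntegral.integral_of_le hh0.le, ← hc]
    refine intervalIntegral.integral_mono_on hh0.le (by simp) hyi fun s hs => ?_
    have h4 : ‖S s x - x‖ < δ / 2 := hη' ⟨hs.1, hs.2.trans_lt hhη⟩
    have h5 := IsMild.norm_sub_le hb hy.isMild hs.1 (hs.2.trans hh1'.le)
    rw [extend_of_nonneg hs.1] at h5
    have hui : IntervalIntegrable (fun s => ‖u s‖) volume 0 h := by
      rw [intervalIntegrable_iff_integrableOn_Ioc_of_le hh0.le]
      exact (hy.isMild.2 h hh0.le).1.norm
    have h6 : ∫ r in (0 : ℝ)..s, ‖u r‖ ≤ ∫ r in (0 : ℝ)..h, ‖u r‖ :=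
      intervalIntegral.integral_mono_interval le_rfl hs.1 hs.2
        (Eventually.of_forall fun _ => norm_nonneg _) hui
    have h7 := integral_norm_le_sqrt_mul hy.memLp_control hh0 (hy.isMild.2 h hh0.le).1
    have h8 : ‖y s - S s x‖ < δ / 2 := by
      refine (h5.trans ?_).trans_lt h3
      gcongr
      refine (h6.trans h7).trans ?_
      gcongr
      refine (quadraticCost_control_le u y _).trans (hcost.trans ?_)
      gcongr
      nlinarith
    have h9 := hδε _ (norm_nonneg (y s)) (by
      refine (abs_norm_sub_norm_le _ _).trans ?_
      refine (norm_sub_le_norm_sub_add_norm_sub _ (S s x) _).trans ?_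
      linarith)
    linarith [(abs_le.1 h9).1]
  simp only [quadraticCost] at hsplit hcost htail
  nlinarith [sq_nonneg ‖L (y h - S h x)‖]

theorem tendsto_value_closedLoop_sub_div (hS : IsC0Semigroup S) {F : Y →L[𝕜] U} {x : Y}
    {z : ℝ → Y} (hzc : Continuous z) (hz : IsMild S B (fun t => F (z t)) x z) :
    Tendsto (fun h : ℝ => h⁻¹ * (‖L (z h)‖ ^ 2 - ‖L (S h x)‖ ^ 2)) (𝓝[>] 0)
      (𝓝 (2 * RCLike.re (inner 𝕜 (L x) (L (B (F x)))))) := by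
  have h1 := hz.tendsto_closedLoop_sub_div hS hzc
  have h2 := (L.continuous.tendsto _).comp h1
  have h3 := (L.continuous.tendsto _).comp (hS.tendsto_zero x)
  have h4 := ((RCLike.continuous_re.tendsto _).comp (h3.inner (𝕜 := 𝕜) h2)).const_mul 2
  have h5 : Tendsto (fun h : ℝ => h) (𝓝[>] 0) (𝓝 0) := nhdsWithin_le_nhds
  -- The quadratic remainder divided by `h` is `h` times the square of a convergent quotient, hence
  -- vanishes in the limit.
  have h6 := h4.add (h5.mul (h2.norm.pow 2))
  rw [zero_mul, add_zero] at h6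
  refine h6.congr' ?_
  filter_upwards [self_mem_nhdsWithin] with h hh
  have hh0 : 0 < h := hh
  have h7 : ‖L (z h)‖ ^ 2 = ‖L (S h x)‖ ^ 2 +
      2 * RCLike.re (inner 𝕜 (L (S h x)) (L (z h - S h x))) + ‖L (z h - S h x)‖ ^ 2 := by
    rw [← norm_add_sq (𝕜 := 𝕜), ← map_add, add_sub_cancel]
  simp only [Function.comp_apply, map_smul, inner_smul_right, RCLike.re_ofReal_mul, norm_smul,
    RCLike.norm_ofReal, abs_of_pos (inv_pos.2 hh0)]
  rw [h7]
  field_simp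
  ring

/-- The feedback contributes `-2 ‖B* L* L x‖²` to the slope, which outweighs the `+‖B* L* L x‖²` of
the free semigroup and leaves `-‖x‖²`. -/
theorem eventually_value_closedLoop_sub_le (hS : IsC0Semigroup S)
    (hL : ∀ u x y, IsAdmissible S B u x y → ‖L x‖ ^ 2 ≤ quadraticCost u y (Ioi 0))
    (hL' : ∀ x, ∀ ε > 0, ∃ u y, IsAdmissible S B u x y ∧
      quadraticCost u y (Ioi 0) ≤ ‖L x‖ ^ 2 + ε) {x : Y} {z : ℝ → Y} (hzc : Continuous z)
    (hz : IsMild S B (fun t => (-(adjoint B).comp ((adjoint L).comp L)) (z t)) x z)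
    {ε : ℝ} (hε : 0 < ε) :
    ∀ᶠ h in 𝓝[>] (0 : ℝ), h⁻¹ * (‖L (z h)‖ ^ 2 - ‖L x‖ ^ 2) < -‖x‖ ^ 2 + ε := by
  have h1 := tendsto_value_closedLoop_sub_div (L := L) hS hzc hz
  have h2 : 2 * RCLike.re (inner 𝕜 (L x) (L (B ((-(adjoint B).comp ((adjoint L).comp L)) x)))) =
      -(2 * ‖adjoint B (adjoint L (L x))‖ ^ 2) := by
    rw [← ContinuousLinearMap.adjoint_inner_left, ← ContinuousLinearMap.adjoint_inner_left]
    simp only [neg_apply, ContinuousLinearMap.comp_apply, inner_neg_right, map_neg, mul_neg,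
      inner_self_eq_norm_sq]
  rw [h2] at h1
  filter_upwards [(tendsto_order.1 h1).2
      (-(2 * ‖adjoint B (adjoint L (L x))‖ ^ 2) + ε / 2) (by linarith),
    eventually_value_semigroup_sub_le hS hL hL' x (by positivity : 0 < ε / 2),
    self_mem_nhdsWithin] with h h3 h4 hh
  have hh0 : 0 < h := hh
  have h5 : h⁻¹ * (‖L (S h x)‖ ^ 2 - ‖L x‖ ^ 2) ≤
      ‖adjoint B (adjoint L (L x))‖ ^ 2 - ‖x‖ ^ 2 + ε / 2 := by
    rw [inv_mul_le_iff₀ hh0]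
    exact h4
  have h6 : h⁻¹ * (‖L (z h)‖ ^ 2 - ‖L x‖ ^ 2) = h⁻¹ * (‖L (z h)‖ ^ 2 - ‖L (S h x)‖ ^ 2) +
      h⁻¹ * (‖L (S h x)‖ ^ 2 - ‖L x‖ ^ 2) := by ring
  rw [h6]
  nlinarith [sq_nonneg ‖adjoint B (adjoint L (L x))‖]

end Decrease

/-! ### From square integrable orbits to exponential decay. -/

section Datko

variable {𝕜 Y : Type*} [RCLike 𝕜] [NormedAddCommGroup Y] [InnerProductSpace 𝕜 Y]
  [CompleteSpace Y] {S : ℝ → Y →L[𝕜] Y}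

open IsC0Semigroup (extend extend_of_nonneg)

theorem IsC0Semigroup.exists_exp_decay_of_norm_le_half (hS : IsC0Semigroup S) {K τ : ℝ}
    (hτ : 0 < τ) (hK : ∀ t, 0 ≤ t → ‖S t‖ ≤ K) (hhalf : ‖S τ‖ ≤ 1 / 2) :
    ∃ C ω : ℝ, 0 < C ∧ 0 < ω ∧ ∀ t, 0 ≤ t → ‖S t‖ ≤ C * Real.exp (-(ω * t)) := by
  have hK0 : 0 ≤ K := (norm_nonneg _).trans (hK 0 le_rfl)
  have hlog : 0 < Real.log 2 := Real.log_pos one_lt_two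
  refine ⟨2 * (K + 1), Real.log 2 / τ, by positivity, by positivity, fun t ht => ?_⟩
  set n := ⌊t / τ⌋₊
  have hn : (n : ℝ) * τ ≤ t := (le_div_iff₀ hτ).1 (Nat.floor_le (div_nonneg ht hτ.le))
  have hn' : t < (n + 1) * τ := (div_lt_iff₀ hτ).1 (Nat.lt_floor_add_one (t / τ))
  have hdec : S t = (S (t - n * τ)).comp (S τ ^ n) := by
    rw [← hS.map_nat_mul hτ.le, ← hS.map_add _ _ (by linarith) (by positivity), sub_add_cancel]
  have hp : ‖S τ ^ n‖ ≤ (1 / 2) ^ n := by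
    rcases Nat.eq_zero_or_pos n with h | h
    · rw [h, pow_zero, pow_zero]
      exact ContinuousLinearMap.norm_id_le
    · exact (norm_pow_le' _ h).trans (pow_le_pow_left₀ (norm_nonneg _) hhalf _)
  have hexp : (1 / 2 : ℝ) ^ n ≤ 2 * Real.exp (-(Real.log 2 / τ * t)) := by
    have h2 : Real.exp (Real.log 2) = 2 := Real.exp_log two_pos
    have h1 : (1 / 2 : ℝ) ^ n = Real.exp (-(n * Real.log 2)) := by
      rw [Real.exp_neg, Real.exp_nat_mul, h2, one_div, inv_pow]
    rw [h1]
    nth_rw 2 [← h2]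
    rw [← Real.exp_add, Real.exp_le_exp]
    have h3 : Real.log 2 / τ * t ≤ Real.log 2 * (n + 1) := by
      rw [div_mul_eq_mul_div, div_le_iff₀ hτ]
      nlinarith
    linarith
  calc ‖S t‖ ≤ ‖S (t - n * τ)‖ * ‖S τ ^ n‖ := by
        rw [hdec]; exact ContinuousLinearMap.opNorm_comp_le _ _
    _ ≤ (K + 1) * (2 * Real.exp (-(Real.log 2 / τ * t))) := by
        gcongr
        · linarith [hK (t - n * τ) (by linarith)]
        · exact hp.trans hexp
    _ = _ := by ring

/-- Datko's theorem. -/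
theorem IsC0Semigroup.exists_exp_decay (hS : IsC0Semigroup S) {c : ℝ} (hc : 0 ≤ c)
    (h : ∀ x t, 0 ≤ t → ∫ s in (0 : ℝ)..t, ‖S s x‖ ^ 2 ≤ c * ‖x‖ ^ 2) :
    ∃ C ω : ℝ, 0 < C ∧ 0 < ω ∧ ∀ t, 0 ≤ t → ‖S t‖ ≤ C * Real.exp (-(ω * t)) := by
  obtain ⟨M, hM, hb⟩ := hS.exists_norm_extend_le 1
  have hb' : ∀ t, 0 ≤ t → t ≤ 1 → ‖S t‖ ≤ M := fun t ht ht1 => by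
    rw [← extend_of_nonneg (S := S) ht]
    exact hb t ht1
  have hi : ∀ x a b, 0 ≤ a → a ≤ b → IntervalIntegrable (fun s => ‖S s x‖ ^ 2) volume a b := by
    intro x a b ha hab
    refine ((hS.continuous_extend_comp continuous_id
      (continuous_const (y := x))).norm.pow 2).continuousOn.intervalIntegrable.congr fun s hs => ?_
    rw [uIoc_of_le hab] at hs
    simp only [Pi.pow_apply, id]
    rw [extend_of_nonneg (ha.trans hs.1.le)]
  -- Writing `S t x = S (t - s) (S s x)` and integrating over `s ∈ [a, t]` is used twice: with `a =
  -- t - 1` it gives a uniform bound `K`, with `a = 0` it gives `t ‖S t x‖² ≤ K² c ‖x‖²`.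
  have hstep : ∀ {N : ℝ} (x : Y) (a t : ℝ), 0 ≤ a → a ≤ t →
      (∀ r, 0 ≤ r → r ≤ t - a → ‖S r‖ ≤ N) → (t - a) * ‖S t x‖ ^ 2 ≤ N ^ 2 * (c * ‖x‖ ^ 2) := by
    intro N x a t ha hat hN
    have h1 : (t - a) * ‖S t x‖ ^ 2 = ∫ _ in a..t, ‖S t x‖ ^ 2 := by
      rw [intervalIntegral.integral_const, smul_eq_mul]
    have h2 : ∫ s in a..t, ‖S s x‖ ^ 2 ≤ c * ‖x‖ ^ 2 := by
      refine le_trans ?_ (h x t (ha.trans hat))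
      rw [← intervalIntegral.integral_add_adjacent_intervals (hi x 0 a le_rfl ha) (hi x a t ha hat)]
      have : 0 ≤ ∫ s in (0 : ℝ)..a, ‖S s x‖ ^ 2 :=
        intervalIntegral.integral_nonneg ha fun _ _ => by positivity
      linarith
    rw [h1]
    refine le_trans ?_ (mul_le_mul_of_nonneg_left h2 (sq_nonneg N))
    rw [← intervalIntegral.integral_const_mul]
    refine intervalIntegral.integral_mono_on hat (by simp) ((hi x a t ha hat).const_mul _)
      fun s hs => ?_
    have h3 : S t x = S (t - s) (S s x) := by
      rw [← ContinuousLinearMap.comp_apply, ← hS.map_add _ _ (by linarith [hs.2])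
        (by linarith [hs.1]), sub_add_cancel]
    rw [h3, ← mul_pow]
    refine pow_le_pow_left₀ (norm_nonneg _) ((ContinuousLinearMap.le_opNorm _ _).trans
      (mul_le_mul_of_nonneg_right (hN _ (by linarith [hs.2]) (by linarith [hs.1]))
        (norm_nonneg _))) 2
  set K := M * √(1 + c)
  have hK2 : K ^ 2 = M ^ 2 * (1 + c) := by
    rw [mul_pow, Real.sq_sqrt (by positivity)]
  have hK : ∀ t, 0 ≤ t → ‖S t‖ ≤ K := by
    intro t ht
    refine ContinuousLinearMap.opNorm_le_bound _ (by positivity) fun x => ?_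
    refine le_of_sq_le_sq ?_ (by positivity)
    rw [mul_pow, hK2]
    rcases le_total t 1 with h1 | h1
    · have h2 : ‖S t x‖ ≤ M * ‖x‖ := (ContinuousLinearMap.le_opNorm _ _).trans
        (mul_le_mul_of_nonneg_right (hb' t ht h1) (norm_nonneg _))
      have h3 := pow_le_pow_left₀ (norm_nonneg _) h2 2
      have : 0 ≤ M ^ 2 * c * ‖x‖ ^ 2 := by positivity
      linarith [mul_pow M ‖x‖ 2]
    · have h2 := hstep (N := M) x (t - 1) t (by linarith) (by linarith)
        fun r hr hr' => hb' r hr (by linarith)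
      have : 0 ≤ M ^ 2 * ‖x‖ ^ 2 := by positivity
      linarith
  have hK0 : 0 ≤ K := by positivity
  -- At this time `τ` one has `K² c / τ ≤ 1/4`, hence `‖S τ‖ ≤ 1/2`.
  refine hS.exists_exp_decay_of_norm_le_half (τ := 4 * (K ^ 2 * c) + 1) (by positivity) hK ?_
  refine ContinuousLinearMap.opNorm_le_bound _ (by norm_num) fun x => ?_
  refine le_of_sq_le_sq ?_ (by positivity)
  have h1 := hstep (N := K) x 0 (4 * (K ^ 2 * c) + 1) le_rfl (by positivity)
    fun r hr _ => hK r hr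
  have h2 : 0 < 4 * (K ^ 2 * c) + 1 := by positivity
  rw [sub_zero, mul_comm, ← le_div_iff₀ h2] at h1
  refine h1.trans ?_
  rw [div_le_iff₀ h2]
  nlinarith [sq_nonneg ‖x‖]

end Datko

/-! ### Stabilization from exponentially decaying open-loop controls. -/

section Stabilization

variable {𝕜 Y U : Type*} [RCLike 𝕜] [NormedAddCommGroup Y] [InnerProductSpace 𝕜 Y]
  [CompleteSpace Y] [NormedAddCommGroup U] [InnerProductSpace 𝕜 U]

open ContinuousLinearMap (adjoint)

theorem IsMild.isC0Semigroup_closedLoop [NormedSpace ℝ Y] {S : ℝ → Y →L[𝕜] Y}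
    (hS : IsC0Semigroup S) {B : U →L[𝕜] Y} {F : Y →L[𝕜] U} {Z : ℝ → Y →L[𝕜] Y}
    (hZ : ∀ x, Continuous (fun t => Z t x) ∧
      IsMild S B (fun t => F (Z t x)) x (fun t => Z t x)) : IsC0Semigroup Z where
  map_zero := ContinuousLinearMap.ext fun x => (hZ x).2.apply_zero hS
  map_add := fun s t hs ht => ContinuousLinearMap.ext fun x =>
    IsMild.closedLoop_add hS (fun x => (hZ x).2) hs ht x
  tendsto_zero := fun x => by
    have := (hZ x).1.tendsto 0
    rw [(hZ x).2.apply_zero hS] at this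
    exact this.mono_left nhdsWithin_le_nhds

/-- `V (z s) + ∫₀ˢ ‖z‖²` does not increase. Only right difference quotients of `V ∘ z` are
controlled, and only from above, so a comparison principle for lower right slopes replaces
differentiation. -/
theorem integral_norm_sq_closedLoop_le [NormedSpace ℝ Y] [CompleteSpace U] {X : Type*}
    [NormedAddCommGroup X] [InnerProductSpace 𝕜 X] [CompleteSpace X] {S : ℝ → Y →L[𝕜] Y}
    (hS : IsC0Semigroup S) {B : U →L[𝕜] Y} {L : Y →L[𝕜] X}
    (hL : ∀ u x y, IsAdmissible S B u x y → ‖L x‖ ^ 2 ≤ quadraticCost u y (Ioi 0))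
    (hL' : ∀ x, ∀ ε > 0, ∃ u y, IsAdmissible S B u x y ∧
      quadraticCost u y (Ioi 0) ≤ ‖L x‖ ^ 2 + ε) {Z : ℝ → Y →L[𝕜] Y}
    (hZ : ∀ x, Continuous (fun t => Z t x) ∧
      IsMild S B (fun t => (-(adjoint B).comp ((adjoint L).comp L)) (Z t x)) x (fun t => Z t x))
    (x : Y) {t : ℝ} (ht : 0 ≤ t) : ∫ s in (0 : ℝ)..t, ‖Z s x‖ ^ 2 ≤ ‖L x‖ ^ 2 := by
  have hc : Continuous fun s => ‖Z s x‖ ^ 2 := (hZ x).1.norm.pow 2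
  have hder : ∀ s, HasDerivAt (fun s => ‖L x‖ ^ 2 - ∫ r in (0 : ℝ)..s, ‖Z r x‖ ^ 2)
      (-‖Z s x‖ ^ 2) s := fun s =>
    (hc.integral_hasStrictDerivAt 0 s).hasDerivAt.const_sub _
  have key := image_le_of_liminf_slope_right_le_deriv_boundary (f := fun s => ‖L (Z s x)‖ ^ 2)
    (a := 0) (b := t) (B := fun s => ‖L x‖ ^ 2 - ∫ r in (0 : ℝ)..s, ‖Z r x‖ ^ 2)
    (B' := fun s => -‖Z s x‖ ^ 2)
    ((L.continuous.comp (hZ x).1).norm.pow 2).continuousOn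
    (by simp [(hZ x).2.apply_zero hS])
    (fun s _ => (hder s).continuousAt.continuousWithinAt)
    (fun s _ => (hder s).hasDerivWithinAt) (fun s hs r hr => ?_) (right_mem_Icc.2 ht)
  · have : 0 ≤ ‖L (Z t x)‖ ^ 2 := by positivity
    linarith
  · have h1 := eventually_value_closedLoop_sub_le hS hL hL' (hZ (Z s x)).1 (hZ (Z s x)).2
      (ε := r + ‖Z s x‖ ^ 2) (by linarith)
    have h2 : Tendsto (fun z => z - s) (𝓝[>] s) (𝓝[>] 0) := by
      refine tendsto_nhdsWithin_iff.2 ⟨?_, ?_⟩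
      · have : Tendsto (fun z => z - s) (𝓝 s) (𝓝 (s - s)) := Continuous.tendsto (by fun_prop) s
        rw [sub_self] at this
        exact this.mono_left nhdsWithin_le_nhds
      · filter_upwards [self_mem_nhdsWithin] with z hz
        exact mem_Ioi.2 (sub_pos.2 (mem_Ioi.1 hz))
    refine Eventually.frequently ?_
    filter_upwards [h2.eventually h1, self_mem_nhdsWithin] with z hz hsz'
    have hsz : s < z := hsz'
    rw [← IsMild.closedLoop_add hS (fun x => (hZ x).2) (sub_pos.2 hsz).le hs.1,
      sub_add_cancel] at hz
    rw [slope_def_field, div_eq_inv_mul]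
    linarith

theorem memLp_two_of_exp_decay {E : Type*} [NormedAddCommGroup E] {f : ℝ → E} {D ω : ℝ}
    (hω : 0 < ω) (hf : AEStronglyMeasurable f (volume.restrict (Ioi 0)))
    (hb : ∀ᵐ t, 0 < t → ‖f t‖ ≤ D * Real.exp (-(ω * t))) :
    MemLp f 2 (volume.restrict (Ioi 0)) ∧ ∫ t in Ioi 0, ‖f t‖ ^ 2 ≤ D ^ 2 / (2 * ω) := by
  have hi : IntegrableOn (fun t => D ^ 2 * Real.exp (-(2 * ω) * t)) (Ioi 0) :=
    (exp_neg_integrableOn_Ioi 0 (by positivity)).const_mul _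
  have hb' : ∀ᵐ t ∂(volume.restrict (Ioi 0)), ‖f t‖ ^ 2 ≤ D ^ 2 * Real.exp (-(2 * ω) * t) := by
    rw [ae_restrict_iff' measurableSet_Ioi]
    filter_upwards [hb] with t ht ht0
    refine (pow_le_pow_left₀ (norm_nonneg _) (ht ht0) 2).trans_eq ?_
    rw [mul_pow, ← Real.exp_nat_mul]
    congr 2
    push_cast
    ring
  have hi2 : IntegrableOn (fun t => ‖f t‖ ^ 2) (Ioi 0) :=
    hi.mono' (hf.norm.pow 2) (hb'.mono fun t ht => by rwa [Real.norm_of_nonneg (by positivity)])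
  refine ⟨(memLp_two_iff_integrable_sq_norm hf).2 hi2, (integral_mono_ae hi2 hi hb').trans_eq ?_⟩
  rw [integral_const_mul, integral_exp_mul_Ioi (by linarith)]
  simp
  field_simp

namespace ControlSystem

/-- The controls may depend on `x` in any way: decay only serves to bound the value function by a
multiple of `‖x‖²`. The linear feedback comes from the operator `L` that represents that function.
-/
theorem ccStabilizable_of_openLoop [CompleteSpace U] (sys : ControlSystem 𝕜 Y U) {C ω : ℝ}
    (hω : 0 < ω) (h : ∀ x, ∃ u y, sys.IsSolution u x y ∧
      (∀ᵐ t, 0 < t → ‖u t‖ ≤ C * Real.exp (-(ω * t)) * ‖x‖) ∧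
      ∀ t, 0 ≤ t → ‖y t‖ ≤ C * Real.exp (-(ω * t)) * ‖x‖) : sys.CCStabilizable := by
  let : NormedSpace ℝ Y := NormedSpace.restrictScalars ℝ 𝕜 Y
  have hS := sys.isC0Semigroup
  -- Control and state each cost at most `C² ‖x‖² / (2 ω)`, together `(C / √ω)² ‖x‖²`.
  obtain ⟨L, hL, hL'⟩ := hS.exists_valueOperator sys.B (M := C / √ω) fun x => by
    obtain ⟨u, y, hsol, hu, hy⟩ := h x
    rw [sys.isSolution_iff] at hsol
    have hum : AEStronglyMeasurable u (volume.restrict (Ioi 0)) := by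
      have : (Ioi (0 : ℝ)) = ⋃ n : ℕ, Ioc 0 (n : ℝ) := by
        ext t
        simp only [mem_Ioi, mem_iUnion, mem_Ioc, exists_and_left]
        exact ⟨fun ht => ⟨ht, exists_nat_ge t⟩, fun ht => ht.1⟩
      rw [this, aestronglyMeasurable_iUnion_iff]
      exact fun n => (hsol.2 n n.cast_nonneg).1.1
    obtain ⟨h1, h1'⟩ := memLp_two_of_exp_decay (D := C * ‖x‖) hω hum
      (hu.mono fun t ht ht0 => (ht ht0).trans_eq (by ring))
    obtain ⟨h2, h2'⟩ := memLp_two_of_exp_decay (D := C * ‖x‖) hω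
      ((hsol.1.mono Ioi_subset_Ici_self).aestronglyMeasurable measurableSet_Ioi)
      (Eventually.of_forall fun t ht0 => (hy t ht0.le).trans_eq (by ring))
    refine ⟨u, y, ⟨hsol, h1, h2⟩, (add_le_add h1' h2').trans_eq ?_⟩
    rw [div_pow, Real.sq_sqrt hω.le]
    field_simp
    ring
  obtain ⟨Z, hZ⟩ := hS.exists_closedLoop sys.B (-(adjoint sys.B).comp ((adjoint L).comp L))
  obtain ⟨C', ω', hC', hω', hdecay⟩ :=
    (IsMild.isC0Semigroup_closedLoop hS hZ).exists_exp_decay (c := ‖L‖ ^ 2) (by positivity)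
      fun x t ht => (integral_norm_sq_closedLoop_le hS hL hL' hZ x ht).trans (by
        rw [← mul_pow]
        exact pow_le_pow_left₀ (norm_nonneg _) (L.le_opNorm x) 2)
  exact sys.ccStabilizable_of_closedLoop hC' hω'
    (fun x => (sys.isSolution_iff _ _ _).2 (hZ x).2) hdecay

theorem CPStabilizable.ccStabilizable [CompleteSpace U] {sys : ControlSystem 𝕜 Y U} {T : ℝ}
    (hT : 0 < T) (h : sys.CPStabilizable T) : sys.CCStabilizable := by
  obtain ⟨F, hF, C, hC, ω, hω, hst⟩ := h
  obtain ⟨M, hM, hFM⟩ := hF.exists_ae_norm_le hT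
  -- The factor `M + 1` dominates both `M`, needed for the control, and `1`, needed for the state.
  refine sys.ccStabilizable_of_openLoop (C := (M + 1) * C) hω fun x => ?_
  obtain ⟨y, hy⟩ := (hst x).1
  have hyb := (hst x).2 y hy
  refine ⟨_, y, hy, ?_, fun t ht => ?_⟩
  · filter_upwards [hFM] with t ht ht0
    calc _ ≤ M * (C * Real.exp (-(ω * t)) * ‖x‖) := (ContinuousLinearMap.le_opNorm _ _).trans
          (mul_le_mul (ht ht0) (hyb t ht0.le) (norm_nonneg _) hM)
      _ ≤ (M + 1) * (C * Real.exp (-(ω * t)) * ‖x‖) := by gcongr; linarith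
      _ = _ := by ring
  · calc _ ≤ 1 * (C * Real.exp (-(ω * t)) * ‖x‖) := by rw [one_mul]; exact hyb t ht
      _ ≤ (M + 1) * (C * Real.exp (-(ω * t)) * ‖x‖) := by gcongr; linarith
      _ = _ := by ring

/-- A sample is at most `T` old, so the sampled state decays at the same rate with an extra factor
`e^{ωT}`. -/
theorem DPStabilizable.ccStabilizable [CompleteSpace U] {sys : ControlSystem 𝕜 Y U} {T : ℝ}
    (hT : 0 < T) (h : sys.DPStabilizable T) : sys.CCStabilizable := by
  obtain ⟨F, hF, C, hC, ω, hω, hst⟩ := h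
  obtain ⟨M, hM, hFM⟩ := hF.exists_ae_norm_le hT
  have he : 1 ≤ Real.exp (ω * T) := Real.one_le_exp (by positivity)
  refine sys.ccStabilizable_of_openLoop (C := (M + 1) * (C * Real.exp (ω * T))) hω fun x => ?_
  obtain ⟨y, hy⟩ := (hst x).1
  have hyb := (hst x).2 y hy
  refine ⟨_, y, hy, ?_, fun t ht => ?_⟩
  · filter_upwards [hFM] with t ht ht0
    have h1 : t - T ≤ (⌊t / T⌋₊ : ℝ) * T := by
      have := (div_lt_iff₀ hT).1 (Nat.lt_floor_add_one (t / T))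
      linarith
    have h2 : ‖sampling T y t‖ ≤ C * Real.exp (ω * T) * Real.exp (-(ω * t)) * ‖x‖ := by
      refine (hyb _ (by positivity)).trans ?_
      rw [mul_assoc C (Real.exp (ω * T)), ← Real.exp_add]
      gcongr
      nlinarith
    calc _ ≤ M * (C * Real.exp (ω * T) * Real.exp (-(ω * t)) * ‖x‖) :=
          (ContinuousLinearMap.le_opNorm _ _).trans (mul_le_mul (ht ht0) h2 (norm_nonneg _) hM)
      _ ≤ (M + 1) * (C * Real.exp (ω * T) * Real.exp (-(ω * t)) * ‖x‖) := by gcongr; linarith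
      _ = _ := by ring
  · calc _ ≤ 1 * (C * 1 * Real.exp (-(ω * t)) * ‖x‖) := by
          rw [one_mul, mul_one]; exact hyb t ht
      _ ≤ (M + 1) * (C * Real.exp (ω * T) * Real.exp (-(ω * t)) * ‖x‖) := by gcongr; linarith
      _ = _ := by ring

end ControlSystem

end Stabilization

/-! ### Ingredients of the counterexample: generators and planar rotations. -/

section Generator

variable {𝕜 Y : Type*} [RCLike 𝕜] [NormedAddCommGroup Y] [InnerProductSpace 𝕜 Y]

/-- Uniqueness of limits makes the limit relation a graph. A control system can thus be built from
its semigroup without computing the generator. -/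
theorem IsC0Semigroup.exists_isGeneratorOf (S : ℝ → Y →L[𝕜] Y) :
    ∃ A : Y →ₗ.[𝕜] Y, IsGeneratorOf A S := by
  let g : Submodule 𝕜 (Y × Y) :=
    { carrier := {p | Tendsto (fun h : ℝ => ((h : 𝕜)⁻¹) • (S h p.1 - p.1)) (𝓝[>] 0) (𝓝 p.2)}
      zero_mem' := by simp
      add_mem' := fun {a b} ha hb => by
        rw [mem_ofPred_eq] at *
        refine (ha.add hb).congr fun h => ?_
        rw [← smul_add, Prod.fst_add, _root_.map_add]
        congr 1
        abel
      smul_mem' := fun c a ha => by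
        rw [mem_ofPred_eq] at *
        refine (ha.const_smul c).congr fun h => ?_
        rw [Prod.smul_fst, map_smul, ← smul_sub, smul_comm] }
  have hg : ∀ x ∈ g, x.1 = 0 → x.2 = 0 := fun x hx h0 => by
    have hx' : Tendsto (fun h : ℝ => ((h : 𝕜)⁻¹) • (S h x.1 - x.1)) (𝓝[>] 0) (𝓝 x.2) := hx
    simp only [h0, _root_.map_zero, sub_self, smul_zero] at hx'
    exact tendsto_nhds_unique hx' tendsto_const_nhds
  refine ⟨g.toLinearPMap, fun y z => ?_⟩
  rw [Submodule.toLinearPMap_graph_eq g hg]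
  exact Iff.rfl

end Generator

theorem intervalIntegral_rclike_ofReal {𝕜 : Type*} [RCLike 𝕜] {f : ℝ → ℝ} (hf : Continuous f)
    (a b : ℝ) : ∫ s in a..b, (f s : 𝕜) = ((∫ s in a..b, f s : ℝ) : 𝕜) :=
  (RCLike.ofRealCLM (K := 𝕜)).intervalIntegral_comp_comm (hf.intervalIntegrable a b)

section Rotation

variable {𝕜 E : Type*} [RCLike 𝕜] [NormedAddCommGroup E] [InnerProductSpace 𝕜 E]

/-- `J` is an orthogonal complex structure. -/
structure IsQuarterTurn (J : E →L[𝕜] E) : Prop where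
  sq_apply : ∀ v, J (J v) = -v
  norm_apply : ∀ v, ‖J v‖ = ‖v‖
  re_inner : ∀ v, RCLike.re (inner 𝕜 v (J v)) = 0

/-- Rotation by the angle `θ` in the planes of a complex structure. -/
noncomputable def planarRotation (J : E →L[𝕜] E) (θ : ℝ) : E →L[𝕜] E :=
  ((Real.cos θ : ℝ) : 𝕜) • ContinuousLinearMap.id 𝕜 E + ((Real.sin θ : ℝ) : 𝕜) • J

theorem planarRotation_apply (J : E →L[𝕜] E) (θ : ℝ) (v : E) :
    planarRotation J θ v = ((Real.cos θ : ℝ) : 𝕜) • v + ((Real.sin θ : ℝ) : 𝕜) • J v := rfl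

theorem planarRotation_zero (J : E →L[𝕜] E) (v : E) : planarRotation J 0 v = v := by
  simp [planarRotation_apply]

theorem continuous_planarRotation (J : E →L[𝕜] E) (v : E) :
    Continuous fun θ => planarRotation J θ v :=
  ((RCLike.continuous_ofReal.comp Real.continuous_cos).smul continuous_const).add
    ((RCLike.continuous_ofReal.comp Real.continuous_sin).smul continuous_const)

theorem IsQuarterTurn.planarRotation_add {J : E →L[𝕜] E} (hJ : IsQuarterTurn J)
    (θ φ : ℝ) (v : E) :
    planarRotation J (θ + φ) v = planarRotation J θ (planarRotation J φ v) := by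
  simp only [planarRotation_apply, Real.cos_add, Real.sin_add, map_add, map_smul, hJ.sq_apply]
  push_cast
  module

theorem IsQuarterTurn.norm_planarRotation {J : E →L[𝕜] E} (hJ : IsQuarterTurn J) (θ : ℝ) (v : E) :
    ‖planarRotation J θ v‖ = ‖v‖ := by
  refine (sq_eq_sq₀ (norm_nonneg _) (norm_nonneg _)).1 ?_
  rw [planarRotation_apply, norm_add_sq (𝕜 := 𝕜), norm_smul, norm_smul, hJ.norm_apply,
    inner_smul_left, inner_smul_right, RCLike.conj_ofReal, RCLike.re_ofReal_mul,
    RCLike.re_ofReal_mul, hJ.re_inner, RCLike.norm_ofReal, RCLike.norm_ofReal, mul_pow, mul_pow,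
    sq_abs, sq_abs]
  linear_combination ‖v‖ ^ 2 * Real.sin_sq_add_cos_sq θ

theorem abs_integral_cos_mul_sub_le {k : ℝ} (hk : 0 < k) (T : ℝ) :
    |∫ s in (0 : ℝ)..T, Real.cos (k * (T - s))| ≤ 2 / k := by
  rw [intervalIntegral.integral_comp_sub_left (fun s => Real.cos (k * s)),
    intervalIntegral.integral_comp_mul_left _ hk.ne', integral_cos, smul_eq_mul, abs_mul,
    abs_of_pos (inv_pos.2 hk), inv_mul_eq_div]
  gcongr
  refine (abs_sub _ _).trans ?_
  linarith [Real.abs_sin_le_one (k * (T - 0)), Real.abs_sin_le_one (k * (T - T))]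

theorem abs_integral_sin_mul_sub_le {k : ℝ} (hk : 0 < k) (T : ℝ) :
    |∫ s in (0 : ℝ)..T, Real.sin (k * (T - s))| ≤ 2 / k := by
  rw [intervalIntegral.integral_comp_sub_left (fun s => Real.sin (k * s)),
    intervalIntegral.integral_comp_mul_left _ hk.ne', integral_sin, smul_eq_mul, abs_mul,
    abs_of_pos (inv_pos.2 hk), inv_mul_eq_div]
  gcongr
  refine (abs_sub _ _).trans ?_
  linarith [Real.abs_cos_le_one (k * (T - 0)), Real.abs_cos_le_one (k * (T - T))]

/-- A fast rotation averages out: the integrals of the cosine and the sine are each at most `2 / k`,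
whatever the length of the interval. -/
theorem IsQuarterTurn.norm_integral_planarRotation_le [NormedSpace ℝ E] [CompleteSpace E]
    {J : E →L[𝕜] E} (hJ : IsQuarterTurn J) {k : ℝ} (hk : 0 < k) (T : ℝ) (v : E) :
    ‖∫ s in (0 : ℝ)..T, planarRotation J (k * (T - s)) v‖ ≤ 4 / k * ‖v‖ := by
  have h1 : Continuous fun s => ((Real.cos (k * (T - s)) : ℝ) : 𝕜) :=
    RCLike.continuous_ofReal.comp (by fun_prop)
  have h2 : Continuous fun s => ((Real.sin (k * (T - s)) : ℝ) : 𝕜) :=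
    RCLike.continuous_ofReal.comp (by fun_prop)
  have hi1 : IntervalIntegrable (fun s => ((Real.cos (k * (T - s)) : ℝ) : 𝕜) • v) volume 0 T :=
    (h1.smul continuous_const).intervalIntegrable _ _
  have hi2 : IntervalIntegrable (fun s => ((Real.sin (k * (T - s)) : ℝ) : 𝕜) • J v) volume 0 T :=
    (h2.smul continuous_const).intervalIntegrable _ _
  simp only [planarRotation_apply]
  rw [intervalIntegral.integral_add hi1 hi2]
  have h3 : ∀ (f : ℝ → ℝ) (w : E), Continuous f → ∫ s in (0 : ℝ)..T, ((f s : ℝ) : 𝕜) • w =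
      ((∫ s in (0 : ℝ)..T, f s : ℝ) : 𝕜) • w := fun f w hf => by
    have := ((ContinuousLinearMap.id 𝕜 𝕜).smulRight w).intervalIntegral_comp_comm
      ((RCLike.continuous_ofReal (K := 𝕜)).comp hf |>.intervalIntegrable (μ := volume) 0 T)
    refine this.trans ?_
    simp only [ContinuousLinearMap.smulRight_apply, ContinuousLinearMap.id_apply,
      Function.comp_apply]
    congr 1
    exact intervalIntegral_rclike_ofReal hf _ _
  rw [h3 _ _ (by fun_prop), h3 _ _ (by fun_prop)]
  refine (norm_add_le _ _).trans ?_
  rw [norm_smul, norm_smul, hJ.norm_apply, RCLike.norm_ofReal, RCLike.norm_ofReal, ← add_mul]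
  gcongr
  refine (add_le_add (abs_integral_cos_mul_sub_le hk T)
    (abs_integral_sin_mul_sub_le hk T)).trans_eq ?_
  ring

/-- The quarter turn `(a, b) ↦ (-b, a)` of `𝕜²`. -/
theorem exists_isQuarterTurn (𝕜 : Type*) [RCLike 𝕜] :
    ∃ J : WithLp 2 (𝕜 × 𝕜) →L[𝕜] WithLp 2 (𝕜 × 𝕜), IsQuarterTurn J := by
  let J : WithLp 2 (𝕜 × 𝕜) →L[𝕜] WithLp 2 (𝕜 × 𝕜) := LinearMap.mkContinuous
    { toFun := fun v => WithLp.toLp 2 (-v.snd, v.fst)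
      map_add' := fun v w => by
        apply WithLp.ofLp_injective
        ext <;> simp [add_comm]
      map_smul' := fun c v => by
        apply WithLp.ofLp_injective
        ext <;> simp } 1 (fun v => by
        rw [one_mul]
        refine le_of_sq_le_sq ?_ (norm_nonneg _)
        rw [WithLp.prod_norm_sq_eq_of_L2, WithLp.prod_norm_sq_eq_of_L2]
        simp [add_comm])
  have hJ : ∀ v, J v = WithLp.toLp 2 (-v.snd, v.fst) := fun v => rfl
  refine ⟨J, fun v => ?_, fun v => ?_, fun v => ?_⟩
  · apply WithLp.ofLp_injective
    ext <;> simp [hJ]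
  · refine (sq_eq_sq₀ (norm_nonneg _) (norm_nonneg _)).1 ?_
    rw [hJ, WithLp.prod_norm_sq_eq_of_L2, WithLp.prod_norm_sq_eq_of_L2]
    simp [add_comm]
  · rw [hJ, WithLp.prod_inner_apply]
    simp [mul_comm]

end Rotation

/-! ### The counterexample: rotations of unbounded frequency on `ℓ²`. -/

section BlockRotation

variable {𝕜 E : Type*} [RCLike 𝕜] [NormedAddCommGroup E] [InnerProductSpace 𝕜 E]
  {J : E →L[𝕜] E}

/-- The group on `ℓ²(ℕ; E)` that rotates the `k`-th component with angular velocity `k`. -/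
noncomputable def blockRotation (hJ : IsQuarterTurn J) (t : ℝ) :
    lp (fun _ : ℕ => E) 2 →L[𝕜] lp (fun _ : ℕ => E) 2 :=
  LinearMap.mkContinuous
    { toFun := fun f => ⟨fun k => planarRotation J (k * t) (f k),
        (lp.memℓp f).mono' fun k => (hJ.norm_planarRotation _ _).le⟩
      map_add' := fun f g => by
        ext k
        exact map_add _ _ _
      map_smul' := fun c f => by
        ext k
        exact map_smul _ _ _ }
    1 fun f => by
      rw [one_mul]
      exact lp.norm_mono two_ne_zero fun k => (hJ.norm_planarRotation _ _).le

theorem blockRotation_apply (hJ : IsQuarterTurn J) (t : ℝ) (f : lp (fun _ : ℕ => E) 2) (k : ℕ) :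
    blockRotation hJ t f k = planarRotation J (k * t) (f k) := rfl

theorem norm_blockRotation_le (hJ : IsQuarterTurn J) (t : ℝ) : ‖blockRotation hJ t‖ ≤ 1 :=
  LinearMap.mkContinuous_norm_le _ zero_le_one _

/-- Each component is continuous in `t`; dominated convergence with majorant `4 ‖f k‖²` handles the
sum over all frequencies. -/
theorem isC0Semigroup_blockRotation (hJ : IsQuarterTurn J) :
    IsC0Semigroup (blockRotation hJ) where
  map_zero := by
    ext f k
    simp [blockRotation_apply, planarRotation_zero]
  map_add := fun s t _ _ => by
    ext f k
    rw [ContinuousLinearMap.comp_apply]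
    simp only [blockRotation_apply]
    rw [mul_add, hJ.planarRotation_add]
  tendsto_zero := fun f => by
    have hsq : ∀ g : lp (fun _ : ℕ => E) 2, ‖g‖ ^ 2 = ∑' k, ‖g k‖ ^ 2 := fun g => by
      have := lp.norm_rpow_eq_tsum (p := 2) (by norm_num) g
      simpa using this
    have hsum : Summable fun k => ‖f k‖ ^ 2 := by
      have := (lp.memℓp f).summable (by norm_num)
      simpa using this
    have h1 : Tendsto (fun t => ‖blockRotation hJ t f - f‖ ^ 2) (𝓝[>] 0) (𝓝 0) := by
      have h2 := tendsto_tsum_of_dominated_convergence (𝓕 := 𝓝[>] (0 : ℝ))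
        (f := fun t (k : ℕ) => ‖planarRotation J (k * t) (f k) - f k‖ ^ 2) (g := fun _ => 0)
        (hsum.mul_left 4) (fun k => ?_) (Eventually.of_forall fun t k => ?_)
      · rw [tsum_zero] at h2
        refine h2.congr fun t => ?_
        rw [hsq]
        rfl
      · have : Continuous fun t : ℝ => ‖planarRotation J (k * t) (f k) - f k‖ ^ 2 :=
          ((((continuous_planarRotation J (f k)).comp (continuous_const.mul continuous_id)).sub
            continuous_const).norm).pow 2
        have h3 := this.tendsto 0
        simp only [mul_zero, planarRotation_zero, sub_self, norm_zero] at h3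
        rw [zero_pow two_ne_zero] at h3
        exact h3.mono_left nhdsWithin_le_nhds
      · rw [Real.norm_of_nonneg (by positivity)]
        have h3 := _root_.norm_sub_le (planarRotation J (k * t) (f k)) (f k)
        rw [hJ.norm_planarRotation] at h3
        nlinarith [norm_nonneg (planarRotation J (k * t) (f k) - f k)]
    rw [tendsto_iff_norm_sub_tendsto_zero]
    have h4 := h1.sqrt
    rw [Real.sqrt_zero] at h4
    exact h4.congr fun t => Real.sqrt_sq (norm_nonneg _)

variable [CompleteSpace E]

open IsC0Semigroup (extend extend_of_nonneg)

/-- With `B = 1` and feedback `-1` the semigroup law turns the integrand into `-e^{-s} S t x`, whose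
integral is explicit. -/
theorem IsMild.exp_decay_smul {𝕜 Y : Type*} [RCLike 𝕜] [NormedAddCommGroup Y]
    [InnerProductSpace 𝕜 Y] [NormedSpace ℝ Y] [CompleteSpace Y] {S : ℝ → Y →L[𝕜] Y}
    (hS : IsC0Semigroup S) (x : Y) :
    IsMild S (ContinuousLinearMap.id 𝕜 Y)
      (fun t => (-ContinuousLinearMap.id 𝕜 Y) ((((Real.exp (-t) : ℝ) : 𝕜) • extend S t) x)) x
      (fun t => (((Real.exp (-t) : ℝ) : 𝕜) • extend S t) x) := by
  have he : Continuous fun t : ℝ => ((Real.exp (-t) : ℝ) : 𝕜) :=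
    RCLike.continuous_ofReal.comp (by fun_prop)
  have hc : Continuous fun t => (((Real.exp (-t) : ℝ) : 𝕜) • extend S t) x :=
    he.smul (hS.continuous_extend_comp continuous_id continuous_const)
  refine ⟨hc.continuousOn, fun t ht => ⟨?_, ?_⟩⟩
  · exact (((-ContinuousLinearMap.id 𝕜 Y).continuous.comp hc).integrableOn_Icc).mono_set
      Ioc_subset_Icc_self
  · have h1 : (∫ s in (0 : ℝ)..t, extend S (t - s) (ContinuousLinearMap.id 𝕜 Y
        ((-ContinuousLinearMap.id 𝕜 Y) ((((Real.exp (-s) : ℝ) : 𝕜) • extend S s) x)))) =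
        ∫ s in (0 : ℝ)..t, (ContinuousLinearMap.toSpanSingleton 𝕜 (extend S t x))
          ((-Real.exp (-s) : ℝ) : 𝕜) := by
      refine intervalIntegral.integral_congr fun s hs => ?_
      rw [uIcc_of_le ht] at hs
      simp only [ContinuousLinearMap.id_apply, neg_apply, smul_apply, map_neg, map_smul,
        ContinuousLinearMap.toSpanSingleton_apply]
      rw [← hS.extend_add (by linarith [hs.2]) hs.1, sub_add_cancel]
      exact smul_neg _ _
    have hi : IntervalIntegrable (fun s : ℝ => ((-Real.exp (-s) : ℝ) : 𝕜)) volume 0 t :=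
      (RCLike.continuous_ofReal.comp (by fun_prop)).intervalIntegrable _ _
    have h2 : ∫ s in (0 : ℝ)..t, -Real.exp (-s) = Real.exp (-t) - 1 := by
      have hd : ∀ s ∈ uIcc 0 t, HasDerivAt (fun s => Real.exp (-s)) (-Real.exp (-s)) s :=
        fun s _ => by simpa using (hasDerivAt_neg s).exp
      rw [intervalIntegral.integral_eq_sub_of_hasDerivAt hd
        (Continuous.intervalIntegrable (by fun_prop) _ _), neg_zero, Real.exp_zero]
    rw [h1, (ContinuousLinearMap.toSpanSingleton 𝕜 (extend S t x)).intervalIntegral_comp_comm hi,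
      ContinuousLinearMap.toSpanSingleton_apply, intervalIntegral_rclike_ofReal (by fun_prop), h2,
      RCLike.ofReal_sub, RCLike.ofReal_one, sub_smul, one_smul, add_sub_cancel]
    rfl

/-- The control system of the block rotation group with full control. -/
theorem exists_controlSystem_blockRotation (hJ : IsQuarterTurn J) :
    ∃ sys : ControlSystem 𝕜 (lp (fun _ : ℕ => E) 2) (lp (fun _ : ℕ => E) 2),
      sys.S = blockRotation hJ ∧ sys.B = ContinuousLinearMap.id 𝕜 _ := by
  obtain ⟨A, hA⟩ := IsC0Semigroup.exists_isGeneratorOf (blockRotation hJ)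
  exact ⟨⟨A, _, isC0Semigroup_blockRotation hJ, hA, ContinuousLinearMap.id 𝕜 _⟩, rfl, rfl⟩

theorem ControlSystem.ccStabilizable_of_blockRotation (hJ : IsQuarterTurn J)
    {sys : ControlSystem 𝕜 (lp (fun _ : ℕ => E) 2) (lp (fun _ : ℕ => E) 2)}
    (hS : sys.S = blockRotation hJ) (hB : sys.B = ContinuousLinearMap.id 𝕜 _) :
    sys.CCStabilizable := by
  let : NormedSpace ℝ (lp (fun _ : ℕ => E) 2) := NormedSpace.restrictScalars ℝ 𝕜 _
  refine sys.ccStabilizable_of_closedLoop (C := 1) (ω := 1) one_pos one_pos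
    (F := -ContinuousLinearMap.id 𝕜 _)
    (Z := fun t => ((Real.exp (-t) : ℝ) : 𝕜) • extend sys.S t) (fun x => ?_) fun t ht => ?_
  · rw [sys.isSolution_iff, hB]
    exact IsMild.exp_decay_smul sys.isC0Semigroup x
  · rw [norm_smul, RCLike.norm_ofReal, abs_of_pos (Real.exp_pos _), one_mul, one_mul, hS]
    exact mul_le_of_le_one_right (Real.exp_pos _).le (norm_blockRotation_le hJ _)

/-- Between samples the control is the constant `F (y (n T))`, whose effect on component `k` is the
integral of a rotating vector and so of size `O(1/k)`. The free motion preserves the norm of that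
component, so it can shrink only slightly. -/
theorem IsMild.norm_sampled_component_le [NormedSpace ℝ (lp (fun _ : ℕ => E) 2)]
    (hJ : IsQuarterTurn J) {T : ℝ} (hT : 0 < T)
    {F : lp (fun _ : ℕ => E) 2 →L[𝕜] lp (fun _ : ℕ => E) 2} {x : lp (fun _ : ℕ => E) 2}
    {y : ℝ → lp (fun _ : ℕ => E) 2}
    (hy : IsMild (blockRotation hJ) (ContinuousLinearMap.id 𝕜 _)
      (fun t => F (sampling T y t)) x y) {k : ℕ} (hk : 0 < k) (n : ℕ) :
    ‖y (n * T) k‖ ≤ ‖y ((n + 1 : ℕ) * T) k‖ + 4 / k * (‖F‖ * ‖y (n * T)‖) := by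
  let : NormedSpace ℝ E := NormedSpace.restrictScalars ℝ 𝕜 E
  have hS := isC0Semigroup_blockRotation hJ
  have hshift := (hy.shift hS (by positivity : (0 : ℝ) ≤ n * T)).2 T hT.le
  have h1 : (∫ s in (0 : ℝ)..T, extend (blockRotation hJ) (T - s)
      (ContinuousLinearMap.id 𝕜 _ (F (sampling T y (s + n * T))))) =
      ∫ s in (0 : ℝ)..T, extend (blockRotation hJ) (T - s) (F (y (n * T))) := by
    refine intervalIntegral.integral_congr_ae ?_
    -- At `s = T` the sampling index already jumps to `n + 1`.
    have hne : ∀ᵐ s : ℝ, s ≠ T := by simp [ae_iff]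
    filter_upwards [hne] with s hs hs'
    rw [uIoc_of_le hT.le] at hs'
    have hst : s < T := lt_of_le_of_ne hs'.2 hs
    have hfl : ⌊(s + n * T) / T⌋₊ = n := by
      rw [add_div, mul_div_cancel_right₀ _ hT.ne', Nat.floor_add_natCast (by
        exact div_nonneg hs'.1.le hT.le), Nat.floor_eq_zero.2 ((div_lt_one hT).2 hst), zero_add]
    simp only [sampling, hfl, ContinuousLinearMap.id_apply]
  have hi : IntervalIntegrable (fun s => extend (blockRotation hJ) (T - s) (F (y (n * T))))
      volume 0 T :=
    (hS.continuous_extend_comp (by fun_prop) continuous_const).intervalIntegrable _ _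
  have h2 : lp.evalCLM 𝕜 (fun _ : ℕ => E) 2 k
      (∫ s in (0 : ℝ)..T, extend (blockRotation hJ) (T - s) (F (y (n * T)))) =
      ∫ s in (0 : ℝ)..T, planarRotation J (k * (T - s)) (F (y (n * T)) k) := by
    rw [← (lp.evalCLM 𝕜 (fun _ : ℕ => E) 2 k).intervalIntegral_comp_comm hi]
    refine intervalIntegral.integral_congr fun s hs => ?_
    rw [uIcc_of_le hT.le] at hs
    simp only
    rw [extend_of_nonneg (by linarith [hs.2])]
    rfl
  have h3 : y ((n + 1 : ℕ) * T) = blockRotation hJ T (y (n * T)) +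
      ∫ s in (0 : ℝ)..T, extend (blockRotation hJ) (T - s) (F (y (n * T))) := by
    rw [← h1, ← extend_of_nonneg (S := blockRotation hJ) hT.le, ← hshift.2]
    congr 1
    push_cast
    ring
  have h4 : y ((n + 1 : ℕ) * T) k = planarRotation J (k * T) (y (n * T) k) +
      ∫ s in (0 : ℝ)..T, planarRotation J (k * (T - s)) (F (y (n * T)) k) := by
    rw [← h2, h3]
    rfl
  have h5 := hJ.norm_integral_planarRotation_le (Nat.cast_pos.2 hk) T (F (y (n * T)) k)
  have h6 : ‖F (y (n * T)) k‖ ≤ ‖F‖ * ‖y (n * T)‖ :=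
    (lp.norm_apply_le_norm two_ne_zero _ _).trans (F.le_opNorm _)
  have h7 : planarRotation J (k * T) (y (n * T) k) = y ((n + 1 : ℕ) * T) k -
      ∫ s in (0 : ℝ)..T, planarRotation J (k * (T - s)) (F (y (n * T)) k) := by
    rw [h4, add_sub_cancel_right]
  rw [← hJ.norm_planarRotation (k * T) (y (n * T) k), h7]
  refine (_root_.norm_sub_le _ _).trans (add_le_add_right (h5.trans ?_) _)
  gcongr

theorem ControlSystem.not_dcStabilizable_of_blockRotation [Nontrivial E] (hJ : IsQuarterTurn J)
    {sys : ControlSystem 𝕜 (lp (fun _ : ℕ => E) 2) (lp (fun _ : ℕ => E) 2)}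
    (hS : sys.S = blockRotation hJ) (hB : sys.B = ContinuousLinearMap.id 𝕜 _) {T : ℝ}
    (hT : 0 < T) : ¬ sys.DCStabilizable T := by
  let : NormedSpace ℝ (lp (fun _ : ℕ => E) 2) := NormedSpace.restrictScalars ℝ 𝕜 _
  rintro ⟨F, C, hC, ω, hω, hst⟩
  obtain ⟨v₀, hv₀⟩ := exists_ne (0 : E)
  obtain ⟨v, hv⟩ : ∃ v : E, ‖v‖ = 1 := ⟨((‖v₀‖⁻¹ : ℝ) : 𝕜) • v₀, by
    rw [norm_smul, RCLike.norm_ofReal, abs_of_nonneg (by positivity),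
      inv_mul_cancel₀ (norm_ne_zero_iff.2 hv₀)]⟩
  have hlim : Tendsto (fun n : ℕ => C * Real.exp (-(ω * (n * T)))) atTop (𝓝 0) := by
    have h1 : Tendsto (fun n : ℕ => ω * (n * T)) atTop atTop :=
      (tendsto_natCast_atTop_atTop.atTop_mul_const hT).const_mul_atTop hω
    simpa using (Real.tendsto_exp_neg_atTop_nhds_zero.comp h1).const_mul C
  obtain ⟨n, hn⟩ := ((tendsto_order.1 hlim).2 (1 / 2) (by norm_num)).exists
  -- The number `n` of steps after which stability forces norm below `1/2` does not depend on the
  -- initial state, so `k` may be chosen afterwards: the total loss `4 n ‖F‖ C / k` in component `k`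
  -- stays below `1/2`.
  obtain ⟨k, hk⟩ := exists_nat_gt (8 * (n * (‖F‖ * C)))
  have hk0 : (0 : ℝ) < k := lt_of_le_of_lt (by positivity) hk
  obtain ⟨y, hy⟩ := (hst (lp.single 2 k v)).1
  have hyb := (hst (lp.single 2 k v)).2 y hy
  have hnorm : ‖(lp.single 2 k v : lp (fun _ : ℕ => E) 2)‖ = 1 := by
    rw [lp.norm_single (by norm_num), hv]
  rw [hnorm] at hyb
  simp only [mul_one] at hyb
  rw [sys.isSolution_iff, hS, hB] at hy
  have hbC : ∀ m : ℕ, ‖y (m * T)‖ ≤ C := fun m =>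
    (hyb _ (by positivity)).trans (mul_le_of_le_one_right hC.le
      (Real.exp_le_one_iff.2 (neg_nonpos.2 (by positivity))))
  have hlow : ∀ m : ℕ, 1 ≤ ‖y (m * T) k‖ + m * (4 / k * (‖F‖ * C)) := by
    intro m
    induction m with
    | zero =>
      rw [Nat.cast_zero, zero_mul, zero_mul, add_zero,
        hy.apply_zero (isC0Semigroup_blockRotation hJ), lp.single_apply_self, hv]
    | succ m ih =>
      have h1 := hy.norm_sampled_component_le hJ hT (Nat.cast_pos.1 hk0) m
      have h2 : 4 / (k : ℝ) * (‖F‖ * ‖y (m * T)‖) ≤ 4 / k * (‖F‖ * C) := by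
        gcongr
        exact hbC m
      push_cast at h1 ⊢
      linarith
  have h1 := hlow n
  have h2 : ‖y (n * T) k‖ < 1 / 2 :=
    (lp.norm_apply_le_norm two_ne_zero _ _).trans_lt ((hyb _ (by positivity)).trans_lt hn)
  have h3 : (n : ℝ) * (4 / k * (‖F‖ * C)) < 1 / 2 := by
    rw [show (n : ℝ) * (4 / k * (‖F‖ * C)) = 4 * (n * (‖F‖ * C)) / k by ring, div_lt_iff₀ hk0]
    linarith
  linarith

end BlockRotation

/-! ### Assembly of the theorem. -/

theorem exists_ccStabilizable_not_dcStabilizable (𝕜 : Type u) [RCLike 𝕜] :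
    ∃ (Y' U' : Type u)
      (_ : NormedAddCommGroup Y') (_ : InnerProductSpace 𝕜 Y') (_ : CompleteSpace Y')
      (_ : NormedAddCommGroup U') (_ : InnerProductSpace 𝕜 U') (_ : CompleteSpace U')
      (sys' : ControlSystem 𝕜 Y' U'),
      sys'.CCStabilizable ∧ ¬ ∃ T : ℝ, 0 < T ∧ sys'.DCStabilizable T := by
  obtain ⟨J, hJ⟩ := exists_isQuarterTurn 𝕜
  obtain ⟨sys, hS, hB⟩ := exists_controlSystem_blockRotation hJ
  have : Nontrivial (WithLp 2 (𝕜 × 𝕜)) := (WithLp.equiv 2 (𝕜 × 𝕜)).nontrivial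
  exact ⟨_, _, inferInstance, inferInstance, inferInstance, inferInstance, inferInstance,
    inferInstance, sys, sys.ccStabilizable_of_blockRotation hJ hS hB,
    fun ⟨_, hT, h⟩ => sys.not_dcStabilizable_of_blockRotation hJ hS hB hT h⟩

theorem theorem1p9 {𝕜 : Type u} [RCLike 𝕜]
    {Y : Type v} [NormedAddCommGroup Y] [InnerProductSpace 𝕜 Y] [CompleteSpace Y]
    {U : Type w} [NormedAddCommGroup U] [InnerProductSpace 𝕜 U] [CompleteSpace U]
    (sys : ControlSystem 𝕜 Y U) :
    -- (i)
    (((∃ T : ℝ, 0 < T ∧ sys.DCStabilizable T) → sys.CCStabilizable) ∧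
      (∃ (Y' U' : Type u)
        (_ : NormedAddCommGroup Y') (_ : InnerProductSpace 𝕜 Y') (_ : CompleteSpace Y')
        (_ : NormedAddCommGroup U') (_ : InnerProductSpace 𝕜 U') (_ : CompleteSpace U')
        (sys' : ControlSystem 𝕜 Y' U'),
        sys'.CCStabilizable ∧ ¬ ∃ T : ℝ, 0 < T ∧ sys'.DCStabilizable T)) ∧
    -- (ii)
    (((∃ T : ℝ, 0 < T ∧ sys.DPStabilizable T) ↔ sys.CCStabilizable) ∧
      ((∀ T : ℝ, 0 < T → sys.DPStabilizable T) ↔ sys.CCStabilizable)) ∧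
    -- (iii)
    (((∃ T : ℝ, 0 < T ∧ sys.CPStabilizable T) ↔ sys.CCStabilizable) ∧
      ((∀ T : ℝ, 0 < T → sys.CPStabilizable T) ↔ sys.CCStabilizable)) ∧
    -- (iv)
    (((∃ T : ℝ, 0 < T ∧ sys.DCStabilizable T) → ∀ T : ℝ, 0 < T → sys.DPStabilizable T) ∧
      (∃ (Y' U' : Type u)
        (_ : NormedAddCommGroup Y') (_ : InnerProductSpace 𝕜 Y') (_ : CompleteSpace Y')
        (_ : NormedAddCommGroup U') (_ : InnerProductSpace 𝕜 U') (_ : CompleteSpace U')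
        (sys' : ControlSystem 𝕜 Y' U'),
        (∀ T : ℝ, 0 < T → sys'.DPStabilizable T) ∧
          ¬ ∃ T : ℝ, 0 < T ∧ sys'.DCStabilizable T)) ∧
    -- (v)
    (((∀ T : ℝ, 0 < T → sys.DPStabilizable T) ↔ (∀ T : ℝ, 0 < T → sys.CPStabilizable T)) ∧
      ((∃ T : ℝ, 0 < T ∧ sys.DPStabilizable T) ↔ (∃ T : ℝ, 0 < T ∧ sys.CPStabilizable T)) ∧
      ((∀ T : ℝ, 0 < T → sys.DPStabilizable T) ↔ (∃ T : ℝ, 0 < T ∧ sys.CPStabilizable T)) ∧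
      ((∃ T : ℝ, 0 < T ∧ sys.DPStabilizable T) ↔ (∀ T : ℝ, 0 < T → sys.CPStabilizable T))) := by
  have dpcc : (∃ T : ℝ, 0 < T ∧ sys.DPStabilizable T) ↔ sys.CCStabilizable :=
    ⟨fun ⟨_, hT, h⟩ => h.ccStabilizable hT, fun h => ⟨1, one_pos, h.dpStabilizable one_pos⟩⟩
  have dpcc' : (∀ T : ℝ, 0 < T → sys.DPStabilizable T) ↔ sys.CCStabilizable :=
    ⟨fun h => (h 1 one_pos).ccStabilizable one_pos, fun h _ hT => h.dpStabilizable hT⟩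
  have cpcc : (∃ T : ℝ, 0 < T ∧ sys.CPStabilizable T) ↔ sys.CCStabilizable :=
    ⟨fun ⟨_, hT, h⟩ => h.ccStabilizable hT, fun h => ⟨1, one_pos, h.cpStabilizable 1⟩⟩
  have cpcc' : (∀ T : ℝ, 0 < T → sys.CPStabilizable T) ↔ sys.CCStabilizable :=
    ⟨fun h => (h 1 one_pos).ccStabilizable one_pos, fun h T _ => h.cpStabilizable T⟩
  have dccc : (∃ T : ℝ, 0 < T ∧ sys.DCStabilizable T) → sys.CCStabilizable :=
    fun ⟨_, hT, h⟩ => h.dpStabilizable.ccStabilizable hT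
  obtain ⟨Y', U', i₁, i₂, i₃, i₄, i₅, i₆, sys', hcc, hdc⟩ :=
    exists_ccStabilizable_not_dcStabilizable 𝕜
  exact ⟨⟨dccc, Y', U', i₁, i₂, i₃, i₄, i₅, i₆, sys', hcc, hdc⟩, ⟨dpcc, dpcc'⟩, ⟨cpcc, cpcc'⟩,
    ⟨fun h => dpcc'.2 (dccc h), Y', U', i₁, i₂, i₃, i₄, i₅, i₆, sys',
      fun _ hT => hcc.dpStabilizable hT, hdc⟩,
    dpcc'.trans cpcc'.symm, dpcc.trans cpcc.symm, dpcc'.trans cpcc.symm, dpcc.trans cpcc'.symm⟩
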